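/- For finite sequences of real numbers $A=(a_1,\dots,a_N)$ and $B=(b_1,\dots,b_N)$ of the same length, write $A\vartriangleright B$ ("$A$ majorizes $B$") if $a_{(1)}+\dots+a_{(j)}\ge b_{(1)}+\dots+b_{(j)}$ for all $j=1,\dots,N$, where $a_{(1)}\le\dots\le a_{(N)}$ and $b_{(1)}\le\dots\le b_{(N)}$ are the nondecreasing rearrangements. For $s\in\mathbb R$ and points $x\neq y$ of $\mathbb R^n$ let $r_s(x,y)=\|x-y\|^s$ if $s>0$, $r_0(x,y)=\log\|x-y\|$, and $r_s(x,y)=-\|x-y\|^s$ if $s<0$. For a finite set $X$ let $R_s(X)$ be the family (with multiplicities) of the values $r_s(x,y)$ over all unordered pairs of distinct points of $X$. For $S\subset\mathbb R^n$, $q>0$ and $m\in\mathbb N$ let $\Omega(S,q,m)$ be the set of all $m$-point subsets of $S$ whose distinct points are at distance at least $q$, and let $M(S,r_s,q,m)$ be the set of all $X\in\Omega(S,q,m)$ such that for every $Y\in\Omega(S,q,m)$ either $R_s(X)\vartriangleright R_s(Y)$, or $R_s(X)$ and $R_s(Y)$ are incomparable (neither majorizes the other). Let $\mathbb B^n$ and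 $\mathbb S^{n-1}$ be the closed unit ball and the unit sphere of $\mathbb R^n$. **Theorem.** Let $2\le k\le n$ be integers and let $s\le 2$. Then $$M(\mathbb B^{n},r_s,\sqrt2,n+k)=M(\mathbb S^{n-1},r_s,\sqrt2,n+k),$$ this set is non-empty, and each of its elements is the union of the vertex sets of $k$ mutually orthogonal regular $d_i$-simplices $S_1,\dots,S_k$ with all $d_i\ge1$ and $d_1+\dots+d_k=n$; that is, there are mutually orthogonal linear subspaces $L_1,\dots,L_k$ of $\mathbb R^n$ with $\dim L_i=d_i$ such that $S_i$ is a regular $d_i$-simplex inscribed in the unit sphere of $L_i$. If moreover $-2\le s\le 2$, then conversely every such union belongs to $M(\mathbb S^{n-1},r_s,\sqrt2,n+k)$. -/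

import Mathlib

noncomputable section

open scoped InnerProductSpace

/-- Weak majorization of finite sequences of reals (given as multisets, since only the
nondecreasing rearrangement matters): the sequences have the same length `N` and, for every
`1 ≤ j ≤ N`, the sum of the `j` smallest terms of `A` is at least that of `B`. -/
def Majorizes (A B : Multiset ℝ) : Prop :=
  A.card = B.card ∧
    ∀ j : ℕ, 1 ≤ j → j ≤ A.card → (B.sort.take j).sum ≤ (A.sort.take j).sum

/-- Symmetric real functions of two variables. -/
abbrev SymmFun (E : Type*) := {f : E → E → ℝ // ∀ a b, f a b = f b a}

/-- The family of values `ρ(x, y)` over the unordered pairs of distinct elements of `X`,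
with multiplicities. -/
def pairValues {E : Type*} [DecidableEq E] (ρ : SymmFun E) (X : Finset E) : Multiset ℝ :=
  (X.sym2.filter fun e => ¬ e.IsDiag).val.map (Sym2.lift ρ)

/-- The `m`-point subsets of `S` whose distinct points have distance at least `q`. -/
def constrainedSets {E : Type*} [MetricSpace E] (S : Set E) (q : ℝ) (m : ℕ) : Set (Finset E) :=
  {X | (X : Set E) ⊆ S ∧ X.card = m ∧ ∀ x ∈ X, ∀ y ∈ X, x ≠ y → q ≤ dist x y}

/-- The `M`-sets: those admissible `X` such that for each admissible `Y` either `X` majorizes `Y`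
or the two are incomparable. -/
def MSets {E : Type*} [MetricSpace E] [DecidableEq E] (S : Set E) (ρ : SymmFun E) (q : ℝ)
    (m : ℕ) : Set (Finset E) :=
  {X | X ∈ constrainedSets S q m ∧ ∀ Y ∈ constrainedSets S q m,
    Majorizes (pairValues ρ X) (pairValues ρ Y) ∨
      (¬ Majorizes (pairValues ρ X) (pairValues ρ Y) ∧
        ¬ Majorizes (pairValues ρ Y) (pairValues ρ X))}

/-- The function `r_s`: `r ^ s` for `s > 0`, `log r` for `s = 0`, `- r ^ s` for `s < 0`,
where `r` is the distance. -/
def rieszFun {E : Type*} [MetricSpace E] (s : ℝ) : SymmFun E :=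
  ⟨fun x y => if 0 < s then dist x y ^ s else if s = 0 then Real.log (dist x y)
    else - dist x y ^ s, fun a b => by simp only [dist_comm a b]⟩

/-- `S` is the vertex set of a regular `d`-simplex. -/
def IsRegularSimplex {E : Type*} [NormedAddCommGroup E] [NormedSpace ℝ E] (d : ℕ)
    (S : Finset E) : Prop :=
  ∃ σ : Affine.Simplex ℝ E d, σ.Equilateral ∧ Set.range σ.points = (S : Set E)

/-- `X` is the union of `k` mutually orthogonal regular simplices of dimensions `d i ≥ 1` with
`∑ d i = n`: there are mutually orthogonal linear subspaces `L i` of dimensions `d i`, and `X` is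
the union of the vertex sets `S i` of regular `d i`-simplices, `S i` being inscribed in the unit
sphere of `L i`. -/
def IsOrthogonalSimplexUnion {E : Type*} [NormedAddCommGroup E] [InnerProductSpace ℝ E]
    (n k : ℕ) (X : Finset E) : Prop :=
  ∃ (d : Fin k → ℕ) (L : Fin k → Submodule ℝ E) (S : Fin k → Finset E),
    (∀ i, 1 ≤ d i) ∧ ∑ i, d i = n ∧
    (∀ i, Module.finrank ℝ (L i) = d i) ∧
    (∀ i j, i ≠ j → L i ⟂ L j) ∧
    (∀ i, IsRegularSimplex (d i) (S i)) ∧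
    (∀ i, ∀ x ∈ S i, x ∈ L i ∧ ‖x‖ = 1) ∧
    (X : Set E) = ⋃ i, (S i : Set E)

end

/-! Points of the unit ball at distance at least `√2` have nonpositive inner product. In `ℝⁿ`, `n +
k` nonzero vectors of this kind split into `k` mutually orthogonal blocks with at least two vectors
each (`exists_orthogonal_blocks`). The comparison model for such a splitting `β` turns each block of
size `M` into a regular `(M - 1)`-simplex inscribed in the unit sphere, distinct blocks staying
orthogonal: squared distances are `2M/(M - 1)` inside a block and `2` across.

The identity `sum_block_eq` shows that no block in the ball has larger mean squared distance than
its model. For `s ≤ 2`, `r_s` is increasing and concave in the squared distance, so tangent lines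
turn this bound on means into majorization by the model (`majorizes_blockDistSq`); equality of the
values forces the configuration to be a model (`IsBlockSimplex.of_pairValues_eq`). Hence only the
finitely many families `blockValues β` matter. By antisymmetry every maximal configuration is a
model, a maximal model exists by finiteness, and ball and sphere agree because models lie on the
sphere.

For the converse, all models share `∑ t` and `∑ 1/t` over their squared distances `t`, which lie in
`[2, 4]`. When `-2 ≤ s ≤ 2`, the function `-16/t - t` is nondecreasing and strictly concave in the
variable `r_s` there, so the equality case of Tomić–Weyl (`Majorizes.eq_of_sum_map_le`) makes
comparable models have equal values. -/

/-! ### Weak majorization, truncated sums and the Tomić–Weyl inequality. -/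

theorem Majorizes.refl (A : Multiset ℝ) : Majorizes A A := ⟨rfl, fun _ _ _ => le_rfl⟩

theorem Majorizes.trans {A B C : Multiset ℝ} (h₁ : Majorizes A B) (h₂ : Majorizes B C) :
    Majorizes A C :=
  ⟨h₁.1.trans h₂.1, fun j hj hjA => (h₂.2 j hj (h₁.1 ▸ hjA)).trans (h₁.2 j hj hjA)⟩

/-- The upper bound of the sum of any initial segment of a list by truncated differences. -/
theorem List.length_mul_sub_sum_take_le (l : List ℝ) (θ : ℝ) :
    ∀ j ≤ l.length, j * θ - (l.take j).sum ≤ (l.map fun a => max (θ - a) 0).sum := by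
  induction l with
  | nil => intro j hj; simp at hj; simp [hj]
  | cons a l ih =>
    intro j hj
    rcases j with _ | j
    · simp only [List.take_zero, List.sum_nil, Nat.cast_zero, zero_mul, sub_zero]
      apply List.sum_nonneg
      simp only [List.mem_map]
      rintro _ ⟨b, -, rfl⟩
      exact le_max_right _ _
    · have := ih j (by simpa using hj)
      have h2 := le_max_left (θ - a) 0
      simp only [List.take_succ_cons, List.sum_cons, List.map_cons]
      push_cast
      linarith

theorem List.sum_map_max_eq_of_le (l : List ℝ) (θ : ℝ) (h : ∀ a ∈ l, a ≤ θ) :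
    (l.map fun a => max (θ - a) 0).sum = l.length * θ - l.sum := by
  induction l with
  | nil => simp
  | cons a l ih =>
    simp only [List.mem_cons, forall_eq_or_imp] at h
    simp only [List.map_cons, List.sum_cons, ih h.2, List.length_cons,
      max_eq_left (sub_nonneg.2 h.1)]
    push_cast
    ring

theorem List.sum_map_max_eq_zero_of_le (l : List ℝ) (θ : ℝ) (h : ∀ a ∈ l, θ ≤ a) :
    (l.map fun a => max (θ - a) 0).sum = 0 := by
  apply List.sum_eq_zero
  simp only [List.mem_map]
  rintro _ ⟨a, ha, rfl⟩
  exact max_eq_right (sub_nonpos.2 (h a ha))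

theorem List.exists_sum_map_max_eq (l : List ℝ) (hl : l.Pairwise (· ≤ ·)) (j : ℕ) (hj : 1 ≤ j)
    (hjl : j ≤ l.length) :
    ∃ θ : ℝ, (l.map fun a => max (θ - a) 0).sum = j * θ - (l.take j).sum := by
  obtain ⟨i, rfl⟩ : ∃ i, j = i + 1 := ⟨j - 1, by omega⟩
  have hi : i < l.length := hjl
  -- With `θ` the `j`-th smallest term, truncation keeps the first `j` differences and kills the
  -- others.
  refine ⟨l[i], ?_⟩
  have h₁ : ∀ a ∈ l.take (i + 1), a ≤ l[i] := by
    intro a ha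
    obtain ⟨m, hm, rfl⟩ := List.mem_iff_getElem.1 ha
    rw [List.getElem_take]
    rw [List.length_take] at hm
    rcases (show m ≤ i by omega).eq_or_lt with rfl | h
    · exact le_rfl
    · exact List.pairwise_iff_getElem.1 hl _ _ _ _ h
  have h₂ : ∀ a ∈ l.drop (i + 1), l[i] ≤ a := by
    intro a ha
    obtain ⟨m, hm, rfl⟩ := List.mem_iff_getElem.1 ha
    rw [List.getElem_drop]
    exact List.pairwise_iff_getElem.1 hl _ _ _ _ (by omega)
  generalize l[i] = θ at *
  conv_lhs => rw [← List.take_append_drop (i + 1) l]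
  rw [List.map_append, List.sum_append, List.sum_map_max_eq_of_le _ _ h₁,
    List.sum_map_max_eq_zero_of_le _ _ h₂, add_zero, List.length_take, min_eq_left hjl]

theorem Multiset.sum_map_sort (A : Multiset ℝ) (f : ℝ → ℝ) :
    (A.sort.map f).sum = (A.map f).sum := by
  conv_rhs => rw [← A.sort_eq (· ≤ ·)]
  rw [Multiset.map_coe, Multiset.sum_coe]

/-- The sum of the `j` smallest terms is the maximum over `θ` of `j * θ - ∑ max (θ - a) 0`, so
comparing the truncated sums for all `θ` suffices. -/
theorem majorizes_of_sum_max_le {A B : Multiset ℝ} (hc : A.card = B.card)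
    (h : ∀ θ : ℝ, (A.map fun a => max (θ - a) 0).sum ≤ (B.map fun a => max (θ - a) 0).sum) :
    Majorizes A B := by
  refine ⟨hc, fun j hj hjA => ?_⟩
  obtain ⟨θ, hθ⟩ := List.exists_sum_map_max_eq B.sort (B.pairwise_sort _) j hj
    (by simpa using hc ▸ hjA)
  have h₁ := List.length_mul_sub_sum_take_le A.sort θ j (by simpa using hjA)
  have h₂ := h θ
  rw [Multiset.sum_map_sort] at h₁ hθ
  linarith

/-- Abel summation: nonincreasing nonnegative weights preserve nonnegativity of partial sums. -/
theorem sum_mul_nonneg_of_antitone (D f : ℕ → ℝ) (n : ℕ)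
    (hD : ∀ i, i + 1 < n → D (i + 1) ≤ D i) (hD₀ : ∀ i < n, 0 ≤ D i)
    (hf : ∀ j ≤ n, 0 ≤ ∑ i ∈ Finset.range j, f i) :
    0 ≤ ∑ i ∈ Finset.range n, D i * f i := by
  have key : ∀ m, m + 1 ≤ n → D m * ∑ i ∈ Finset.range (m + 1), f i ≤
      ∑ i ∈ Finset.range (m + 1), D i * f i := by
    intro m
    induction m with
    | zero => simp
    | succ m ih =>
      intro hm
      have h₁ := ih (by omega)
      have h₂ := mul_le_mul_of_nonneg_right (hD m (by omega)) (hf (m + 1) (by omega))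
      rw [Finset.sum_range_succ, Finset.sum_range_succ (fun i => D i * f i), mul_add]
      linarith
  rcases n with _ | n
  · simp
  · exact (mul_nonneg (hD₀ n (by omega)) (hf _ le_rfl)).trans (key n le_rfl)

/-- The equality case of the Tomić–Weyl inequality: if `A` majorizes `B` and `ψ` is strictly
concave and nondecreasing (`D` being a nonnegative supergradient), then
`∑ ψ(A) ≤ ∑ ψ(B)` forces `A = B`. -/
theorem Majorizes.eq_of_sum_map_le {A B : Multiset ℝ} (h : Majorizes A B) (I : Set ℝ)
    (hA : ∀ a ∈ A, a ∈ I) (hB : ∀ b ∈ B, b ∈ I) (ψ D : ℝ → ℝ) (hD : ∀ a ∈ I, 0 ≤ D a)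
    (hψ : ∀ a ∈ I, ∀ b ∈ I, a ≠ b → ψ b < ψ a + D a * (b - a))
    (hsum : (A.map ψ).sum ≤ (B.map ψ).sum) : A = B := by
  rw [← A.sort_eq (· ≤ ·), ← B.sort_eq (· ≤ ·)]
  congr 1
  have hlA : A.sort.length = A.card := A.length_sort _
  have hlB : B.sort.length = A.card := by rw [h.1]; exact B.length_sort _
  have hsA := A.pairwise_sort (· ≤ ·)
  rw [← Multiset.sum_map_sort, ← Multiset.sum_map_sort] at hsum
  replace hA : ∀ a ∈ A.sort, a ∈ I := fun a ha => hA a (by simpa using ha)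
  replace hB : ∀ a ∈ B.sort, a ∈ I := fun a ha => hB a (by simpa using ha)
  have hm := h.2
  generalize A.card = N at *
  generalize A.sort = a at *
  generalize B.sort = b at *
  have take_sum : ∀ (l : List ℝ) (j : ℕ), j ≤ l.length →
      (l.take j).sum = ∑ i ∈ Finset.range j, l.getD i 0 := by
    intro l j hj
    induction j with
    | zero => simp
    | succ j ih =>
      rw [Finset.sum_range_succ, ← ih (by omega), List.sum_take_succ l j (by omega),
        List.getD_eq_getElem _ _ (by omega)]
  have map_sum : ∀ (l : List ℝ), l.length = N →
      (l.map ψ).sum = ∑ i ∈ Finset.range N, ψ (l.getD i 0) := by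
    intro l hl
    subst hl
    have := (Fin.sum_univ_getElem (l.map ψ)).symm
    rw [this, Finset.sum_range]
    refine Fintype.sum_equiv (finCongr (by simp)) _ _ fun i => ?_
    have hi : (i : ℕ) < l.length := by simpa using i.2
    rw [List.getElem_map, finCongr_apply_coe, List.getD_eq_getElem _ _ hi]
  rw [map_sum _ hlA, map_sum _ hlB] at hsum
  have memA : ∀ i < N, a.getD i 0 ∈ I := fun i hi => by
    rw [List.getD_eq_getElem _ _ (by omega)]; exact hA _ (List.getElem_mem _)
  have memB : ∀ i < N, b.getD i 0 ∈ I := fun i hi => by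
    rw [List.getD_eq_getElem _ _ (by omega)]; exact hB _ (List.getElem_mem _)
  have hψ' : ∀ x ∈ I, ∀ y ∈ I, ψ y ≤ ψ x + D x * (y - x) := by
    intro x hx y hy
    by_cases hxy : x = y
    · simp [hxy]
    · exact (hψ x hx y hy hxy).le
  have key : 0 ≤ ∑ i ∈ Finset.range N, D (a.getD i 0) * (a.getD i 0 - b.getD i 0) := by
    apply sum_mul_nonneg_of_antitone (fun i => D (a.getD i 0))
    · intro i hi
      have h₁ := memA i (by omega)
      have h₂ := memA (i + 1) hi
      have h₃ : a.getD i 0 ≤ a.getD (i + 1) 0 := by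
        rw [List.getD_eq_getElem _ _ (by omega), List.getD_eq_getElem _ _ (by omega)]
        exact List.pairwise_iff_getElem.1 hsA _ _ _ _ (by omega)
      rcases h₃.eq_or_lt with h₃ | h₃
      · simp only [h₃]; exact le_rfl
      · have h₄ := hψ' _ h₁ _ h₂
        have h₅ := hψ' _ h₂ _ h₁
        by_contra! h₆
        nlinarith [mul_pos (sub_pos.2 h₆) (sub_pos.2 h₃)]
    · exact fun i hi => hD _ (memA i hi)
    · intro j hj
      rw [Finset.sum_sub_distrib, ← take_sum _ _ (by omega), ← take_sum _ _ (by omega)]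
      rcases Nat.eq_zero_or_pos j with rfl | hj0
      · simp
      · exact sub_nonneg.2 (hm j hj0 hj)
  by_contra hne
  obtain ⟨i, hi, hi'⟩ : ∃ i < N, a.getD i 0 ≠ b.getD i 0 := by
    by_contra! hcon
    apply hne
    apply List.ext_getElem (by omega)
    intro i h₁ h₂
    have := hcon i (by omega)
    rwa [List.getD_eq_getElem _ _ h₁, List.getD_eq_getElem _ _ h₂] at this
  have hlt : ∑ i ∈ Finset.range N, ψ (b.getD i 0) <
      ∑ i ∈ Finset.range N, (ψ (a.getD i 0) +
        D (a.getD i 0) * (b.getD i 0 - a.getD i 0)) := by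
    apply Finset.sum_lt_sum
    · intro j hj
      rw [Finset.mem_range] at hj
      exact hψ' _ (memA j hj) _ (memB j hj)
    · exact ⟨i, Finset.mem_range.2 hi, hψ _ (memA i hi) _ (memB i hi) hi'⟩
  rw [Finset.sum_add_distrib] at hlt
  have : ∑ i ∈ Finset.range N, D (a.getD i 0) * (b.getD i 0 - a.getD i 0) =
      - ∑ i ∈ Finset.range N, D (a.getD i 0) * (a.getD i 0 - b.getD i 0) := by
    rw [← Finset.sum_neg_distrib]
    exact Finset.sum_congr rfl fun _ _ => by ring
  linarith

theorem Majorizes.antisymm {A B : Multiset ℝ} (h₁ : Majorizes A B) (h₂ : Majorizes B A) :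
    A = B := by
  rw [← A.sort_eq (· ≤ ·), ← B.sort_eq (· ≤ ·)]
  congr 1
  have hlA : A.sort.length = A.card := A.length_sort _
  have hlB : B.sort.length = A.card := by rw [h₁.1]; exact B.length_sort _
  have key : ∀ j ≤ A.card, (A.sort.take j).sum = (B.sort.take j).sum := by
    intro j hj
    rcases Nat.eq_zero_or_pos j with rfl | hj0
    · simp
    · exact le_antisymm (h₂.2 j hj0 (h₁.1 ▸ hj)) (h₁.2 j hj0 hj)
  apply List.ext_getElem (by omega)
  intro i hi hi'
  have e₁ := key i (by omega)
  have e₂ := key (i + 1) (by omega)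
  rw [List.sum_take_succ _ i hi, List.sum_take_succ _ i hi'] at e₂
  linarith

/-! ### Values over unordered pairs, indexed by `a < b`. -/

/-- The pairs `(a, b)` of indices with `a < b`. -/
def indexPairs (N : ℕ) : Finset (Fin N × Fin N) := Finset.univ.filter fun p => p.1 < p.2

theorem pairValues_image {E : Type*} [DecidableEq E] (ρ : SymmFun E) {N : ℕ} (x : Fin N → E)
    (hx : Function.Injective x) :
    pairValues ρ (Finset.univ.image x) =
      (indexPairs N).val.map fun p => ρ.1 (x p.1) (x p.2) := by
  have h : ((Finset.univ.image x).sym2.filter fun e => ¬ e.IsDiag) =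
      (indexPairs N).image fun p => s(x p.1, x p.2) := by
    ext e
    induction e with | _ u v
    simp only [indexPairs, Finset.mem_filter, Finset.mk_mem_sym2_iff, Finset.mem_image,
      Finset.mem_univ, true_and, Sym2.mk_isDiag_iff, Prod.exists]
    constructor
    · rintro ⟨⟨⟨a, rfl⟩, b, rfl⟩, hab⟩
      rcases lt_trichotomy a b with h | h | h
      · exact ⟨a, b, h, rfl⟩
      · exact absurd (congrArg x h) hab
      · exact ⟨b, a, h, Sym2.eq_swap⟩
    · rintro ⟨a, b, hab, h⟩
      have hne : x a ≠ x b := fun h => hab.ne (hx h)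
      rcases Sym2.eq_iff.1 h with ⟨rfl, rfl⟩ | ⟨rfl, rfl⟩
      · exact ⟨⟨⟨a, rfl⟩, b, rfl⟩, hne⟩
      · exact ⟨⟨⟨b, rfl⟩, a, rfl⟩, hne.symm⟩
  rw [pairValues, h, Finset.image_val_of_injOn, Multiset.map_map]
  · rfl
  · rintro ⟨a, b⟩ hab ⟨c, d⟩ hcd h
    simp only [indexPairs, Finset.coe_filter, Finset.mem_univ, true_and, Set.mem_ofPred_eq]
      at hab hcd
    rcases Sym2.eq_iff.1 h with ⟨h₁, h₂⟩ | ⟨h₁, h₂⟩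
    · exact Prod.ext (hx h₁) (hx h₂)
    · obtain rfl := hx h₁
      obtain rfl := hx h₂
      exact absurd hab hcd.not_gt

theorem two_mul_sum_indexPairs {N : ℕ} (F : Fin N → Fin N → ℝ) (hF : ∀ a b, F a b = F b a) :
    2 * ∑ p ∈ indexPairs N, F p.1 p.2 = ∑ a, ∑ b, if a = b then 0 else F a b := by
  have h₁ : ∑ p ∈ indexPairs N, F p.1 p.2 = ∑ a, ∑ b, if a < b then F a b else 0 := by
    rw [indexPairs, Finset.sum_filter, Fintype.sum_prod_type]
  have h₂ : ∑ p ∈ indexPairs N, F p.1 p.2 = ∑ a, ∑ b, if b < a then F a b else 0 := by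
    rw [h₁, Finset.sum_comm]
    simp only [hF]
  rw [two_mul]
  nth_rewrite 1 [h₁]
  rw [h₂, ← Finset.sum_add_distrib]
  refine Finset.sum_congr rfl fun a _ => ?_
  rw [← Finset.sum_add_distrib]
  refine Finset.sum_congr rfl fun b _ => ?_
  rcases lt_trichotomy a b with h | h | h
  · simp [h, h.not_gt, h.ne]
  · simp [h]
  · simp [h, h.not_gt, h.ne']

theorem indexPairs_ne {N : ℕ} {p : Fin N × Fin N} (hp : p ∈ indexPairs N) : p.1 ≠ p.2 :=
  (Finset.mem_filter.1 hp).2.ne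

/-! ### The functions `r_s` in terms of the squared distance. -/

/-- `rieszFun s` as a function of the squared distance. -/
noncomputable def rieszSq (s t : ℝ) : ℝ :=
  if 0 < s then t ^ (s / 2) else if s = 0 then Real.log t / 2 else - t ^ (s / 2)

theorem rieszFun_eq_rieszSq {E : Type*} [MetricSpace E] (s : ℝ) (x y : E) :
    (rieszFun s).1 x y = rieszSq s (dist x y ^ 2) := by
  have h : (dist x y ^ 2) ^ (s / 2) = dist x y ^ s := by
    rw [← Real.rpow_natCast_mul dist_nonneg]
    congr 1
    push_cast
    ring
  simp only [rieszFun, rieszSq, h, Real.log_pow]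
  push_cast
  congr 2
  ring

theorem Real.rpow_le_one_add_mul_sub {u p : ℝ} (hu : 0 < u) (hp₀ : 0 ≤ p) (hp₁ : p ≤ 1) :
    u ^ p ≤ 1 + p * (u - 1) := by
  have := rpow_one_add_le_one_add_mul_self (s := u - 1) (by linarith) hp₀ hp₁
  simpa using this

theorem Real.one_add_mul_sub_le_rpow {u p : ℝ} (hu : 0 < u) (hp : p ≤ 0) :
    1 + p * (u - 1) ≤ u ^ p := by
  rw [Real.rpow_def_of_pos hu]
  have h₁ := Real.add_one_le_exp (Real.log u * p)
  have h₂ := Real.log_le_sub_one_of_pos hu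
  nlinarith

/-- Two-sided comparison of `rieszSq s` with its linearization at `c`, and with the linearization
in the variable `1 / t`. -/
theorem rieszSq_tangent {s : ℝ} (hs : s ≤ 2) {c : ℝ} (hc : 0 < c) :
    ∃ m > 0, ∀ t > 0, rieszSq s t ≤ rieszSq s c + m * (t - c) ∧
      (-2 ≤ s → rieszSq s c + m * (c * (1 - c / t)) ≤ rieszSq s t) := by
  rcases lt_trichotomy s 0 with hs0 | rfl | hs0
  · have hcp := Real.rpow_pos_of_pos hc (s / 2)
    -- `m` is the derivative at `c`. Both bounds are Bernoulli-type inequalities, in `t / c` and in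
    -- its inverse.
    refine ⟨-s / 2 * c ^ (s / 2) / c, by positivity [neg_pos.2 hs0], fun t ht => ?_⟩
    have hu : 0 < t / c := by positivity
    have e : t ^ (s / 2) = c ^ (s / 2) * (t / c) ^ (s / 2) := by
      rw [← Real.mul_rpow hc.le hu.le, mul_div_cancel₀ _ hc.ne']
    simp only [rieszSq, hs0.not_gt, hs0.ne, if_false, e]
    constructor
    · have h := mul_le_mul_of_nonneg_left
        (Real.one_add_mul_sub_le_rpow (p := s / 2) hu (by linarith)) hcp.le
      have e₂ : -s / 2 * c ^ (s / 2) / c * (t - c) = - (c ^ (s / 2) * (s / 2 * (t / c - 1))) := by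
        field_simp
      rw [e₂]
      linarith
    · intro hs2
      have h := mul_le_mul_of_nonneg_left
        (Real.rpow_le_one_add_mul_sub (p := -(s / 2)) (inv_pos.2 hu) (by linarith) (by linarith))
          hcp.le
      rw [Real.inv_rpow hu.le, Real.rpow_neg hu.le, inv_inv] at h
      have e₂ : -s / 2 * c ^ (s / 2) / c * (c * (1 - c / t)) =
          c ^ (s / 2) * (s / 2 * ((t / c)⁻¹ - 1)) := by
        field_simp
        ring
      rw [e₂]
      linarith
  · refine ⟨1 / (2 * c), by positivity, fun t ht => ?_⟩
    have hu : 0 < t / c := by positivity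
    have e : Real.log t = Real.log c + Real.log (t / c) := by
      rw [Real.log_div ht.ne' hc.ne']; ring
    simp only [rieszSq, lt_irrefl, if_false, if_true, e]
    constructor
    · have h := Real.log_le_sub_one_of_pos hu
      have e₂ : 1 / (2 * c) * (t - c) = (t / c - 1) / 2 := by field_simp
      rw [e₂]
      linarith
    · intro _
      have h := Real.one_sub_inv_le_log_of_pos hu
      have e₂ : 1 / (2 * c) * (c * (1 - c / t)) = (1 - (t / c)⁻¹) / 2 := by field_simp
      rw [e₂]
      linarith
  · have hcp := Real.rpow_pos_of_pos hc (s / 2)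
    refine ⟨s / 2 * c ^ (s / 2) / c, by positivity, fun t ht => ?_⟩
    have hu : 0 < t / c := by positivity
    have e : t ^ (s / 2) = c ^ (s / 2) * (t / c) ^ (s / 2) := by
      rw [← Real.mul_rpow hc.le hu.le, mul_div_cancel₀ _ hc.ne']
    simp only [rieszSq, hs0, if_true, e]
    constructor
    · have h := mul_le_mul_of_nonneg_left
        (Real.rpow_le_one_add_mul_sub (p := s / 2) hu (by linarith) (by linarith)) hcp.le
      have e₂ : s / 2 * c ^ (s / 2) / c * (t - c) = c ^ (s / 2) * (s / 2 * (t / c - 1)) := by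
        field_simp
      rw [e₂]
      linarith
    · intro hs2
      have h := mul_le_mul_of_nonneg_left
        (Real.one_add_mul_sub_le_rpow (p := -(s / 2)) (inv_pos.2 hu) (by linarith)) hcp.le
      rw [Real.inv_rpow hu.le, Real.rpow_neg hu.le, inv_inv] at h
      have e₂ : s / 2 * c ^ (s / 2) / c * (c * (1 - c / t)) =
          - (c ^ (s / 2) * (s / 2 * ((t / c)⁻¹ - 1))) := by
        field_simp
        ring
      rw [e₂]
      linarith

theorem rieszSq_injOn {s : ℝ} (hs : s ≤ 2) : Set.InjOn (rieszSq s) (Set.Ioi 0) := by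
  apply StrictMonoOn.injOn
  intro a ha b hb hab
  obtain ⟨m, hm, h⟩ := rieszSq_tangent hs (Set.mem_Ioi.1 hb)
  nlinarith [(h a ha).1]

/-- If `R_s`-values majorize, they are equal provided that the totals of the squared distances
and of their inverses agree. -/
theorem Majorizes.eq_of_rieszSq {s : ℝ} (hs : s ≤ 2) (hs' : -2 ≤ s) {A B : Multiset ℝ}
    (h : Majorizes (A.map (rieszSq s)) (B.map (rieszSq s)))
    (hA : ∀ a ∈ A, a ∈ Set.Icc (2 : ℝ) 4) (hB : ∀ b ∈ B, b ∈ Set.Icc (2 : ℝ) 4)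
    (hsum : A.sum = B.sum) (hinv : (A.map fun t => t⁻¹).sum = (B.map fun t => t⁻¹).sum) :
    A.map (rieszSq s) = B.map (rieszSq s) := by
  classical
  set I := Set.Icc (2 : ℝ) 4
  have hinj : Set.InjOn (rieszSq s) I :=
    (rieszSq_injOn hs).mono fun t ht => lt_of_lt_of_le two_pos ht.1
  set g := Function.invFunOn (rieszSq s) I
  have hg : ∀ t ∈ I, g (rieszSq s t) = t := fun t ht => hinj.leftInvOn_invFunOn ht
  have htan : ∀ c : ℝ, ∃ m, c ∈ I → 0 < m ∧ ∀ t > 0, rieszSq s t ≤ rieszSq s c + m * (t - c) ∧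
      (rieszSq s c + m * (c * (1 - c / t)) ≤ rieszSq s t) := by
    intro c
    by_cases hc : c ∈ I
    · obtain ⟨m, hm, h⟩ := rieszSq_tangent hs (lt_of_lt_of_le two_pos hc.1)
      exact ⟨m, fun _ => ⟨hm, fun t ht => ⟨(h t ht).1, (h t ht).2 hs'⟩⟩⟩
    · exact ⟨0, fun h => absurd h hc⟩
  choose m hm using htan
  have hmap : ∀ C : Multiset ℝ, (∀ a ∈ C, a ∈ I) →
      ((C.map (rieszSq s)).map fun r => -16 * (g r)⁻¹ - g r).sum =
        -16 * (C.map fun t => t⁻¹).sum - C.sum := by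
    intro C hC
    rw [Multiset.map_map, ← Multiset.sum_map_mul_left]
    conv_rhs => rw [← Multiset.map_id C, Multiset.map_map]
    rw [← Multiset.sum_map_sub]
    congr 1
    refine Multiset.map_congr rfl fun t ht => ?_
    simp [hg t (hC t ht)]
  -- In the variable `r = r_s(t)`, both `-1/t` (as `-2 ≤ s`) and `-t` (as `s ≤ 2`) are concave,
  -- never both affine. The factor `16` makes `16/t² - 1`, the `t`-derivative of `-16/t - t`,
  -- nonnegative up to `t = 4`; dividing by `m` converts it to an `r`-derivative.
  refine h.eq_of_sum_map_le (rieszSq s '' I) ?_ ?_ (fun r => -16 * (g r)⁻¹ - g r)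
    (fun r => (16 / g r ^ 2 - 1) / m (g r)) ?_ ?_ ?_
  · intro a ha
    obtain ⟨t, ht, rfl⟩ := Multiset.mem_map.1 ha
    exact ⟨t, hA t ht, rfl⟩
  · intro a ha
    obtain ⟨t, ht, rfl⟩ := Multiset.mem_map.1 ha
    exact ⟨t, hB t ht, rfl⟩
  · rintro _ ⟨c, hc, rfl⟩
    simp only [hg c hc]
    have hc0 : 0 < c := lt_of_lt_of_le two_pos hc.1
    refine div_nonneg ?_ (hm c hc).1.le
    rw [sub_nonneg, le_div_iff₀ (by positivity)]
    nlinarith [hc.2]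
  · rintro _ ⟨c, hc, rfl⟩ _ ⟨t, ht, rfl⟩ hne
    have hct : c ≠ t := fun h => hne (congrArg _ h)
    simp only [hg c hc, hg t ht]
    have hc0 : 0 < c := lt_of_lt_of_le two_pos hc.1
    have ht0 : 0 < t := lt_of_lt_of_le two_pos ht.1
    obtain ⟨hm0, h⟩ := hm c hc
    obtain ⟨h₁, h₂⟩ := h t ht0
    set Φ := (rieszSq s t - rieszSq s c) / m c with hΦ
    have e : (16 / c ^ 2 - 1) / m c * (rieszSq s t - rieszSq s c) = (16 / c ^ 2 - 1) * Φ := by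
      rw [hΦ]; ring
    have h₁' : Φ ≤ t - c := by rw [hΦ, div_le_iff₀ hm0]; linarith
    have h₂' : c * (1 - c / t) ≤ Φ := by rw [hΦ, le_div_iff₀ hm0]; linarith
    rw [e]
    have h₃ := mul_le_mul_of_nonneg_left h₂' (show 0 ≤ 16 / c ^ 2 by positivity)
    have e₃ : 16 / c ^ 2 * (c * (1 - c / t)) = 16 * c⁻¹ - 16 * t⁻¹ := by field_simp
    rw [e₃] at h₃
    have hlt : c * (1 - c / t) < t - c := by
      have : t - c - c * (1 - c / t) = (t - c) ^ 2 / t := by field_simp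
      have : 0 < (t - c) ^ 2 / t := by
        have := sub_ne_zero.2 hct.symm
        positivity
      linarith
    -- `Φ` lies between two distinct bounds, so at least one of the two inequalities is strict.
    rcases h₁'.eq_or_lt with h₄ | h₄
    · have h₅ := mul_lt_mul_of_pos_left (hlt.trans_eq h₄.symm) (show 0 < 16 / c ^ 2 by positivity)
      rw [e₃] at h₅
      nlinarith
    · nlinarith
  · rw [hmap A hA, hmap B hB, hsum, hinv]

/-! ### Orthogonal splitting of vectors with nonpositive inner products. -/

section Decomposition

variable {E : Type*} [NormedAddCommGroup E] [InnerProductSpace ℝ E] {ι : Type*} [DecidableEq ι]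

open scoped InnerProductSpace

/-- A minimal dependent subfamily works: nonpositivity forces a dependency with all coefficients
positive, which in turn forces orthogonality to every other vector. -/
theorem exists_circuit_of_inner_nonpos (x : ι → E) (hx₀ : ∀ a, x a ≠ 0)
    (hx : ∀ a b, a ≠ b → ⟪x a, x b⟫_ℝ ≤ 0) (T : Finset ι)
    (hT : ¬ LinearIndepOn ℝ x (T : Set ι)) :
    ∃ A ⊆ T, 2 ≤ A.card ∧ (∀ a ∈ A, ∀ b ∉ A, ⟪x a, x b⟫_ℝ = 0) ∧
      A.card ≤ Module.finrank ℝ (Submodule.span ℝ (x '' A)) + 1 := by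
  classical
  obtain ⟨A, hA, hmin⟩ := Finset.exists_min_image
    (T.powerset.filter fun A : Finset ι => ¬ LinearIndepOn ℝ x (A : Set ι)) Finset.card
    ⟨T, by simpa using hT⟩
  simp only [Finset.mem_filter, Finset.mem_powerset, and_imp] at hA hmin
  obtain ⟨hAT, hA⟩ := hA
  have hindep : ∀ B ⊂ A, LinearIndepOn ℝ x (B : Set ι) := by
    intro B hB
    by_contra hcon
    exact (Finset.card_lt_card hB).not_ge (hmin B (hB.1.trans hAT) hcon)
  obtain ⟨f, hf, i, hi, hfi⟩ : ∃ f : ι → ℝ, ∑ a ∈ A, f a • x a = 0 ∧ ∃ i ∈ A, 0 < f i := by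
    rw [linearIndepOn_finset_iff] at hA
    push Not at hA
    obtain ⟨f, hf, i, hi, hfi⟩ := hA
    rcases hfi.lt_or_gt with h | h
    · refine ⟨-f, ?_, i, hi, by simpa using h⟩
      simp [Finset.sum_neg_distrib, hf]
    · exact ⟨f, hf, i, hi, h⟩
  have hsplit := Finset.sum_filter_add_sum_filter_not A (fun a => 0 < f a) fun a => f a • x a
  rw [hf] at hsplit
  -- The positive part `P` is minus the nonpositive part, so `⟪P, P⟫` is a sum of nonpositive terms.
  -- By minimality the positive part is then all of `A`.
  have hPz : ∑ a ∈ A with 0 < f a, f a • x a = 0 := by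
    rw [← real_inner_self_nonpos]
    nth_rewrite 2 [eq_neg_of_add_eq_zero_left hsplit]
    rw [inner_neg_right, sum_inner, neg_nonpos]
    refine Finset.sum_nonneg fun a ha => ?_
    rw [inner_sum]
    refine Finset.sum_nonneg fun b hb => ?_
    rw [Finset.mem_filter] at ha hb
    rw [real_inner_smul_left, real_inner_smul_right]
    have hab : a ≠ b := by rintro rfl; exact hb.2 ha.2
    exact mul_nonneg ha.2.le (mul_nonneg_of_nonpos_of_nonpos (not_lt.1 hb.2) (hx a b hab))
  have hPA : A.filter (fun a => 0 < f a) = A := by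
    by_contra hne
    have := hindep _ ((Finset.filter_subset _ A).ssubset_of_ne hne)
    rw [linearIndepOn_finset_iff] at this
    exact hfi.ne' (this f hPz i (Finset.mem_filter.2 ⟨hi, hfi⟩))
  have hpos : ∀ a ∈ A, 0 < f a := fun a ha => by
    rw [← hPA] at ha; exact (Finset.mem_filter.1 ha).2
  refine ⟨A, hAT, ?_, ?_, ?_⟩
  · by_contra! hlt
    have : A = {i} := Finset.eq_singleton_iff_unique_mem.2
      ⟨hi, fun b hb => Finset.card_le_one.1 (by omega) b hb i hi⟩
    rw [this, Finset.sum_singleton] at hf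
    rcases smul_eq_zero.1 hf with h | h
    · exact hfi.ne' h
    · exact hx₀ i h
  · intro a ha b hb
    have h₀ : ∑ c ∈ A, f c * ⟪x c, x b⟫_ℝ = 0 := by
      simp only [← real_inner_smul_left, ← sum_inner, hf, inner_zero_left]
    have h₁ := (Finset.sum_eq_zero_iff_of_nonpos fun c hc =>
      mul_nonpos_of_nonneg_of_nonpos (hpos c hc).le
        (hx c b (by rintro rfl; exact hb hc))).1 h₀ a ha
    exact (mul_eq_zero.1 h₁).resolve_left (hpos a ha).ne'
  · have h₁ : LinearIndepOn ℝ x ((A.erase i : Finset ι) : Set ι) :=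
      hindep _ (Finset.erase_ssubset hi)
    have h₂ := finrank_span_eq_card (R := ℝ) h₁
    have h₃ : Set.range (fun a : ((A.erase i : Finset ι) : Set ι) => x a) ⊆ x '' A := by
      rintro _ ⟨⟨a, ha⟩, rfl⟩
      exact ⟨a, Finset.mem_of_mem_erase ha, rfl⟩
    have : FiniteDimensional ℝ (Submodule.span ℝ (x '' A)) :=
      FiniteDimensional.span_of_finite ℝ (A.finite_toSet.image x)
    have h₄ := Submodule.finrank_mono (Submodule.span_mono (R := ℝ) h₃)
    rw [h₂] at h₄
    have h₅ := Finset.card_erase_of_mem hi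
    simp only [Finset.coe_sort_coe, Fintype.card_coe] at h₄
    omega

theorem Submodule.IsOrtho.finrank_add_le [FiniteDimensional ℝ E] {U V W : Submodule ℝ E}
    (h : U ⟂ V) (hU : U ≤ W) (hV : V ≤ W) :
    Module.finrank ℝ U + Module.finrank ℝ V ≤ Module.finrank ℝ W := by
  have h₁ := Submodule.finrank_sup_add_finrank_inf_eq U V
  rw [h.disjoint.eq_bot, finrank_bot, add_zero] at h₁
  rw [← h₁]
  exact Submodule.finrank_mono (sup_le hU hV)

/-- If nonzero vectors have pairwise nonpositive inner products and their number exceeds their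
rank by at least `k ≥ 1`, they split into `k` mutually orthogonal blocks with at least two vectors
each. -/
theorem exists_orthogonal_blocks [FiniteDimensional ℝ E] (x : ι → E) (hx₀ : ∀ a, x a ≠ 0)
    (hx : ∀ a b, a ≠ b → ⟪x a, x b⟫_ℝ ≤ 0) (k : ℕ) :
    ∀ T : Finset ι, Module.finrank ℝ (Submodule.span ℝ (x '' T)) + (k + 1) ≤ T.card →
      ∃ β : ι → ℕ, (∀ a ∈ T, β a < k + 1) ∧
        (∀ i < k + 1, 2 ≤ (T.filter fun a => β a = i).card) ∧
        ∀ a ∈ T, ∀ b ∈ T, β a ≠ β b → ⟪x a, x b⟫_ℝ = 0 := by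
  induction k with
  | zero =>
    intro T hT
    refine ⟨fun _ => 0, by simp, ?_, by simp⟩
    intro i hi
    obtain rfl : i = 0 := by omega
    obtain ⟨a, ha⟩ : T.Nonempty := Finset.card_pos.1 (by omega)
    have : 0 < Module.finrank ℝ (Submodule.span ℝ (x '' T)) := by
      rw [Module.finrank_pos_iff_exists_ne_zero]
      exact ⟨⟨x a, Submodule.subset_span ⟨a, ha, rfl⟩⟩, fun h => hx₀ a (congrArg Subtype.val h)⟩
    simp only [Finset.filter_true]
    omega
  | succ k ih =>
    intro T hT
    have hdep : ¬ LinearIndepOn ℝ x (T : Set ι) := by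
      intro h
      have h₂ := finrank_span_eq_card (R := ℝ) h
      rw [← Set.image_eq_range] at h₂
      simp only [Finset.coe_sort_coe, Fintype.card_coe] at h₂
      omega
    -- Removing the circuit loses at least `A.card - 1` dimensions by orthogonality, so the excess
    -- of number over rank drops by at most one.
    obtain ⟨A, hAT, hA2, hort, hAcard⟩ := exists_circuit_of_inner_nonpos x hx₀ hx T hdep
    have hperp : Submodule.span ℝ (x '' A) ⟂ Submodule.span ℝ (x '' (T \ A : Finset ι)) := by
      rw [Submodule.isOrtho_span]
      rintro _ ⟨a, ha, rfl⟩ _ ⟨b, hb, rfl⟩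
      exact hort a ha b (Finset.mem_sdiff.1 hb).2
    have hdim := hperp.finrank_add_le
      (Submodule.span_mono (Set.image_mono (Finset.coe_subset.2 hAT)))
      (Submodule.span_mono (Set.image_mono (Finset.coe_subset.2 Finset.sdiff_subset)))
    have hcard := Finset.card_sdiff_add_card_eq_card hAT
    obtain ⟨β, hβ, hβ2, hβo⟩ := ih (T \ A) (by omega)
    refine ⟨fun a => if a ∈ A then k + 1 else β a, ?_, ?_, ?_⟩
    · intro a ha
      dsimp only
      split_ifs with h
      · omega
      · have := hβ a (Finset.mem_sdiff.2 ⟨ha, h⟩)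
        omega
    · intro i hi
      rcases (show i ≤ k + 1 by omega).eq_or_lt with rfl | hi'
      · refine hA2.trans (Finset.card_le_card fun a ha => ?_)
        simp [ha, hAT ha]
      · refine (hβ2 i hi').trans (Finset.card_le_card fun a ha => ?_)
        simp only [Finset.mem_filter, Finset.mem_sdiff] at ha ⊢
        exact ⟨ha.1.1, by rw [if_neg ha.1.2, ha.2]⟩
    · intro a ha b hb hab
      dsimp only at hab
      by_cases h₁ : a ∈ A <;> by_cases h₂ : b ∈ A
      · simp [h₁, h₂] at hab
      · exact hort a h₁ b h₂
      · rw [real_inner_comm]; exact hort b h₂ a h₁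
      · rw [if_neg h₁, if_neg h₂] at hab
        exact hβo a (Finset.mem_sdiff.2 ⟨ha, h₁⟩) b (Finset.mem_sdiff.2 ⟨hb, h₂⟩) hab

end Decomposition

/-! ### Comparison of a configuration with its block model. -/

section Blocks

open scoped InnerProductSpace

variable {E : Type*} [NormedAddCommGroup E] [InnerProductSpace ℝ E] {N k : ℕ}

/-- The number of indices in the `i`-th block. -/
def blockSize (β : Fin N → Fin k) (i : Fin k) : ℕ := (Finset.univ.filter fun a => β a = i).card

/-- The squared distances between points of the blocks `i` and `j` in a union of mutually
orthogonal regular simplices inscribed in the unit sphere. -/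
noncomputable def blockDistSq (β : Fin N → Fin k) (i j : Fin k) : ℝ :=
  if i = j then 2 + 2 / (blockSize β i - 1 : ℝ) else 2

/-- The family `x` consists of unit vectors, each block of it forming a regular simplex and
distinct blocks being orthogonal. -/
structure IsBlockSimplex (β : Fin N → Fin k) (x : Fin N → E) : Prop where
  norm_eq : ∀ a, ‖x a‖ = 1
  norm_sub_sq : ∀ a b, a ≠ b → ‖x a - x b‖ ^ 2 = blockDistSq β (β a) (β b)

/-- The `R_s`-values of a union of mutually orthogonal regular simplices. -/
noncomputable def blockValues (β : Fin N → Fin k) (s : ℝ) : Multiset ℝ :=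
  ((indexPairs N).val.map fun p => blockDistSq β (β p.1) (β p.2)).map (rieszSq s)

theorem blockDistSq_comm (β : Fin N → Fin k) (i j : Fin k) :
    blockDistSq β i j = blockDistSq β j i := by
  unfold blockDistSq
  by_cases h : i = j
  · subst h; rfl
  · rw [if_neg h, if_neg (Ne.symm h)]

theorem blockDistSq_mem_Icc {β : Fin N → Fin k} (hβ : ∀ i, 2 ≤ blockSize β i) (i j : Fin k) :
    blockDistSq β i j ∈ Set.Icc (2 : ℝ) 4 := by
  have h : (2 : ℝ) ≤ blockSize β i := by exact_mod_cast hβ i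
  unfold blockDistSq
  split_ifs
  · have h₁ : 0 ≤ 2 / (blockSize β i - 1 : ℝ) := div_nonneg two_pos.le (by linarith)
    have h₂ : 2 / (blockSize β i - 1 : ℝ) ≤ 2 := by
      rw [div_le_iff₀ (by linarith)]
      linarith
    constructor <;> linarith
  · constructor <;> norm_num

theorem sum_sum_norm_sub_sq {ι : Type*} (s : Finset ι) (x : ι → E) :
    ∑ a ∈ s, ∑ b ∈ s, ‖x a - x b‖ ^ 2 =
      2 * s.card * ∑ a ∈ s, ‖x a‖ ^ 2 - 2 * ‖∑ a ∈ s, x a‖ ^ 2 := by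
  have h : ‖∑ a ∈ s, x a‖ ^ 2 = ∑ a ∈ s, ∑ b ∈ s, ⟪x a, x b⟫_ℝ := by
    rw [← real_inner_self_eq_norm_sq, sum_inner]
    simp only [inner_sum]
  rw [h]
  simp only [norm_sub_sq_real, Finset.sum_add_distrib, Finset.sum_sub_distrib, Finset.sum_const,
    nsmul_eq_mul, ← Finset.mul_sum]
  ring

theorem sum_eq_sum_blocks (β : Fin N → Fin k) (F : Fin N → Fin N → ℝ) :
    ∑ a, ∑ b, (if β a = β b then F a b else 0) =
      ∑ i, ∑ a with β a = i, ∑ b with β b = i, F a b := by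
  rw [← Finset.sum_fiberwise Finset.univ β]
  refine Finset.sum_congr rfl fun i _ => Finset.sum_congr rfl fun a ha => ?_
  rw [(Finset.mem_filter.1 ha).2, Finset.sum_filter]
  refine Finset.sum_congr rfl fun b _ => ?_
  simp only [eq_comm]

/-- The model distance satisfies `M (M - 1) c = 2 M²`, which makes the deficit an exact sum of two
terms, nonnegative in the ball: one measures the distance from the sphere, the other that of the
centroid from the origin. -/
theorem sum_block_eq {β : Fin N → Fin k} (hβ : ∀ i, 2 ≤ blockSize β i) (x : Fin N → E)
    (i : Fin k) :
    ∑ a with β a = i, ∑ b with β b = i,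
        (if a = b then 0 else blockDistSq β i i - ‖x a - x b‖ ^ 2) =
      2 * blockSize β i * ∑ a with β a = i, (1 - ‖x a‖ ^ 2) +
        2 * ‖∑ a with β a = i, x a‖ ^ 2 := by
  have hM : (2 : ℝ) ≤ blockSize β i := by exact_mod_cast hβ i
  have h₁ : ∀ a b, (if a = b then 0 else blockDistSq β i i - ‖x a - x b‖ ^ 2) =
      blockDistSq β i i - ‖x a - x b‖ ^ 2 - if a = b then blockDistSq β i i else 0 := by
    intro a b
    split_ifs with h
    · simp [h]
    · ring
  simp only [h₁, Finset.sum_sub_distrib, sum_sum_norm_sub_sq]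
  have h₂ : ∑ a with β a = i, ∑ b with β b = i, (if a = b then blockDistSq β i i else 0) =
      blockSize β i * blockDistSq β i i := by
    rw [blockSize, ← nsmul_eq_mul, ← Finset.sum_const]
    refine Finset.sum_congr rfl fun a ha => ?_
    rw [Finset.sum_ite_eq, if_pos ha]
  rw [h₂]
  have h₃ : (Finset.univ.filter fun a => β a = i).card = blockSize β i := rfl
  simp only [Finset.sum_const, nsmul_eq_mul, mul_one, h₃]
  rw [blockDistSq, if_pos rfl]
  have : (blockSize β i - 1 : ℝ) ≠ 0 := by linarith
  field_simp
  ring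

/-- Points of the unit ball whose blocks are orthogonal have, in the mean over each pair of blocks,
squared distances at most those of the regular simplices. -/
theorem sum_weight_mul_sub_nonneg {β : Fin N → Fin k} (hβ : ∀ i, 2 ≤ blockSize β i)
    {x : Fin N → E} (hx : ∀ a, ‖x a‖ ≤ 1) (ho : ∀ a b, β a ≠ β b → ⟪x a, x b⟫_ℝ = 0)
    (w : ℝ → ℝ) (hw : ∀ c, 0 ≤ w c) :
    0 ≤ ∑ p ∈ indexPairs N, w (blockDistSq β (β p.1) (β p.2)) *
      (blockDistSq β (β p.1) (β p.2) - ‖x p.1 - x p.2‖ ^ 2) := by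
  have hdouble := two_mul_sum_indexPairs (fun a b => w (blockDistSq β (β a) (β b)) *
      (blockDistSq β (β a) (β b) - ‖x a - x b‖ ^ 2))
      (fun a b => by rw [blockDistSq_comm, norm_sub_rev])
  have hsq : ∀ a, ‖x a‖ ^ 2 ≤ 1 := fun a => pow_le_one₀ (norm_nonneg _) (hx a)
  -- Pairs across blocks can be dropped: by orthogonality their squared distance is `‖x a‖² + ‖x b‖²
  -- ≤ 2`.
  have hle : ∑ a, ∑ b, (if β a = β b then (w (blockDistSq β (β a) (β a)) *
      if a = b then 0 else (blockDistSq β (β a) (β a) - ‖x a - x b‖ ^ 2)) else 0) ≤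
      ∑ a, ∑ b, if a = b then 0 else w (blockDistSq β (β a) (β b)) *
      (blockDistSq β (β a) (β b) - ‖x a - x b‖ ^ 2) := by
    refine Finset.sum_le_sum fun a _ => Finset.sum_le_sum fun b _ => ?_
    by_cases hab : a = b
    · simp [hab]
    · by_cases hβab : β a = β b
      · simp [hβab, hab]
      · rw [if_neg hβab, if_neg hab]
        refine mul_nonneg (hw _) ?_
        rw [blockDistSq, if_neg hβab, norm_sub_sq_real, ho a b hβab]
        linarith [hsq a, hsq b]
  have hblock : 0 ≤ ∑ a, ∑ b, (if β a = β b then (w (blockDistSq β (β a) (β a)) *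
      if a = b then 0 else (blockDistSq β (β a) (β a) - ‖x a - x b‖ ^ 2)) else 0) := by
    rw [sum_eq_sum_blocks]
    refine Finset.sum_nonneg fun i _ => ?_
    have : ∑ a with β a = i, ∑ b with β b = i, (w (blockDistSq β (β a) (β a)) *
        if a = b then 0 else (blockDistSq β (β a) (β a) - ‖x a - x b‖ ^ 2)) =
        w (blockDistSq β i i) * ∑ a with β a = i, ∑ b with β b = i,
          (if a = b then 0 else blockDistSq β i i - ‖x a - x b‖ ^ 2) := by
      simp only [Finset.mul_sum]
      refine Finset.sum_congr rfl fun a ha => ?_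
      rw [(Finset.mem_filter.1 ha).2]
    rw [this, sum_block_eq hβ]
    refine mul_nonneg (hw _) (add_nonneg (mul_nonneg (by positivity) ?_) (by positivity))
    exact Finset.sum_nonneg fun a _ => sub_nonneg.2 (hsq a)
  linarith

theorem IsBlockSimplex.of_norm_sub_sq {β : Fin N → Fin k} (hβ : ∀ i, 2 ≤ blockSize β i)
    {x : Fin N → E} (hx : ∀ a, ‖x a‖ ≤ 1)
    (h : ∀ a b, a ≠ b → ‖x a - x b‖ ^ 2 = blockDistSq β (β a) (β b)) : IsBlockSimplex β x := by
  refine ⟨fun a => ?_, h⟩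
  have hsq : ∀ a, ‖x a‖ ^ 2 ≤ 1 := fun a => pow_le_one₀ (norm_nonneg _) (hx a)
  have h₁ := sum_block_eq hβ x (β a)
  rw [Finset.sum_eq_zero] at h₁
  · have hM : (2 : ℝ) ≤ blockSize β (β a) := by exact_mod_cast hβ _
    have h₂ : 0 ≤ ∑ b with β b = β a, (1 - ‖x b‖ ^ 2) :=
      Finset.sum_nonneg fun b _ => sub_nonneg.2 (hsq b)
    have h₃ : ∑ b with β b = β a, (1 - ‖x b‖ ^ 2) = 0 := by
      nlinarith [sq_nonneg ‖∑ b with β b = β a, x b‖]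
    have h₄ := (Finset.sum_eq_zero_iff_of_nonneg fun b _ => sub_nonneg.2 (hsq b)).1 h₃ a (by simp)
    nlinarith [norm_nonneg (x a)]
  · intro b hb
    refine Finset.sum_eq_zero fun c hc => ?_
    rw [Finset.mem_filter] at hb hc
    split_ifs with hbc
    · rfl
    · rw [h b c hbc, hb.2, hc.2, sub_self]

theorem pairValues_rieszFun_image {E : Type*} [NormedAddCommGroup E] [DecidableEq E] (s : ℝ)
    {x : Fin N → E}
    (hx : Function.Injective x) :
    pairValues (rieszFun s) (Finset.univ.image x) =
      ((indexPairs N).val.map fun p => ‖x p.1 - x p.2‖ ^ 2).map (rieszSq s) := by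
  rw [pairValues_image _ _ hx, Multiset.map_map]
  simp only [rieszFun_eq_rieszSq, dist_eq_norm, Function.comp_def]

namespace IsBlockSimplex

theorem injective {E : Type*} [NormedAddCommGroup E] {β : Fin N → Fin k}
    (hβ : ∀ i, 2 ≤ blockSize β i) {x : Fin N → E}
    (hx : IsBlockSimplex β x) : Function.Injective x := by
  intro a b hab
  by_contra hne
  have h₁ := hx.norm_sub_sq a b hne
  have h₂ := (blockDistSq_mem_Icc hβ (β a) (β b)).1
  rw [← h₁, hab] at h₂
  norm_num at h₂

theorem pairValues_eq {E : Type*} [NormedAddCommGroup E] [DecidableEq E]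
    {β : Fin N → Fin k} (hβ : ∀ i, 2 ≤ blockSize β i)
    {x : Fin N → E} (hx : IsBlockSimplex β x) (s : ℝ) :
    pairValues (rieszFun s) (Finset.univ.image x) =
      blockValues β s := by
  rw [pairValues_rieszFun_image s (hx.injective hβ), blockValues]
  congr 1
  exact Multiset.map_congr rfl fun p hp => hx.norm_sub_sq _ _ (indexPairs_ne hp)

end IsBlockSimplex

/-- For each `θ`, use the tangent at the model distance `c` when its value is below `θ`, and the
bound by `0` otherwise. The slopes depend on `c` alone, hence are constant on blocks, and the mean
inequality applies. -/
theorem majorizes_blockDistSq [DecidableEq E] {s : ℝ} (hs : s ≤ 2) {β : Fin N → Fin k}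
    (hβ : ∀ i, 2 ≤ blockSize β i) {x : Fin N → E} (hinj : Function.Injective x)
    (hx : ∀ a, ‖x a‖ ≤ 1) (ho : ∀ a b, β a ≠ β b → ⟪x a, x b⟫_ℝ = 0) :
    Majorizes (blockValues β s)
      (pairValues (rieszFun s) (Finset.univ.image x)) := by
  rw [pairValues_rieszFun_image s hinj, blockValues]
  refine majorizes_of_sum_max_le (by simp) fun θ => ?_
  simp only [Multiset.map_map, Function.comp_def]
  change ∑ p ∈ indexPairs N, max (θ - rieszSq s (blockDistSq β (β p.1) (β p.2))) 0 ≤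
    ∑ p ∈ indexPairs N, max (θ - rieszSq s (‖x p.1 - x p.2‖ ^ 2)) 0
  have htan : ∀ c : ℝ, ∃ m, 0 < m ∧ (0 < c → ∀ t > 0,
      rieszSq s t ≤ rieszSq s c + m * (t - c)) := by
    intro c
    by_cases hc : 0 < c
    · obtain ⟨m, hm, h⟩ := rieszSq_tangent hs hc
      exact ⟨m, hm, fun _ t ht => (h t ht).1⟩
    · exact ⟨1, one_pos, fun h => absurd h hc⟩
  choose m hm htan using htan
  have h := sum_weight_mul_sub_nonneg hβ hx ho (fun c => if rieszSq s c < θ then m c else 0)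
    (fun c => by
      split_ifs
      · exact (hm c).le
      · exact le_rfl)
  suffices h' : ∑ p ∈ indexPairs N, max (θ - rieszSq s (blockDistSq β (β p.1) (β p.2))) 0 +
      ∑ p ∈ indexPairs N, (if rieszSq s (blockDistSq β (β p.1) (β p.2)) < θ then
        m (blockDistSq β (β p.1) (β p.2)) else 0) *
      (blockDistSq β (β p.1) (β p.2) - ‖x p.1 - x p.2‖ ^ 2) ≤
      ∑ p ∈ indexPairs N, max (θ - rieszSq s (‖x p.1 - x p.2‖ ^ 2)) 0 by linarith
  rw [← Finset.sum_add_distrib]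
  refine Finset.sum_le_sum fun p hp => ?_
  have hc := (blockDistSq_mem_Icc hβ (β p.1) (β p.2)).1
  have ht : 0 < ‖x p.1 - x p.2‖ ^ 2 := by
    have := sub_ne_zero.2 (hinj.ne (indexPairs_ne hp))
    positivity
  generalize blockDistSq β (β p.1) (β p.2) = c at *
  have := htan c (by linarith) _ ht
  have h₁ := le_max_left (θ - rieszSq s (‖x p.1 - x p.2‖ ^ 2)) 0
  have h₂ := le_max_right (θ - rieszSq s (‖x p.1 - x p.2‖ ^ 2)) 0
  split_ifs with hθ
  · rw [max_eq_left (by linarith)]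
    linarith
  · rw [max_eq_right (by linarith)]
    linarith

theorem Multiset.eq_of_map_eq_of_injOn {α γ : Type*} {f : α → γ} {I : Set α} (hf : Set.InjOn f I)
    {A B : Multiset α} (hA : ∀ a ∈ A, a ∈ I) (hB : ∀ b ∈ B, b ∈ I) (h : A.map f = B.map f) :
    A = B := by
  rcases isEmpty_or_nonempty α with hα | hα
  · exact Subsingleton.elim _ _
  have key : ∀ C : Multiset α, (∀ a ∈ C, a ∈ I) → (C.map f).map (Function.invFunOn f I) = C := by
    intro C hC
    rw [Multiset.map_map]
    conv_rhs => rw [← Multiset.map_id C]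
    exact Multiset.map_congr rfl fun a ha => hf.leftInvOn_invFunOn (hC a ha)
  rw [← key A hA, h, key B hB]

/-- Equality of multisets does not match the pairs. It does equate the sums of `1/t`, and strict
convexity of `1/t` with the mean inequality then gives `t = c` pair by pair. -/
theorem IsBlockSimplex.of_pairValues_eq [DecidableEq E] {s : ℝ} (hs : s ≤ 2) {β : Fin N → Fin k}
    (hβ : ∀ i, 2 ≤ blockSize β i) {x : Fin N → E} (hinj : Function.Injective x)
    (hx : ∀ a, ‖x a‖ ≤ 1) (ho : ∀ a b, β a ≠ β b → ⟪x a, x b⟫_ℝ = 0)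
    (h : pairValues (rieszFun s) (Finset.univ.image x) =
      blockValues β s) :
    IsBlockSimplex β x := by
  have ht : ∀ a b, a ≠ b → 0 < ‖x a - x b‖ ^ 2 := fun a b hab => by
    have := sub_ne_zero.2 (hinj.ne hab)
    positivity
  rw [pairValues_rieszFun_image s hinj, blockValues] at h
  replace h := Multiset.eq_of_map_eq_of_injOn (rieszSq_injOn hs) (by
      intro t hmem
      obtain ⟨p, hp, rfl⟩ := Multiset.mem_map.1 hmem
      exact ht _ _ (indexPairs_ne hp)) (by
      intro t hmem
      obtain ⟨p, hp, rfl⟩ := Multiset.mem_map.1 hmem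
      exact lt_of_lt_of_le two_pos (blockDistSq_mem_Icc hβ _ _).1) h
  have hinv := congrArg (fun A => (A.map fun t : ℝ => t⁻¹).sum) h
  simp only [Multiset.map_map, Function.comp_def] at hinv
  change ∑ p ∈ indexPairs N, (‖x p.1 - x p.2‖ ^ 2)⁻¹ =
    ∑ p ∈ indexPairs N, (blockDistSq β (β p.1) (β p.2))⁻¹ at hinv
  have hw := sum_weight_mul_sub_nonneg hβ hx ho (fun c => (c ^ 2)⁻¹) (fun c => by positivity)
  -- The remainder of the tangent line of `1/t` at `c`, computed exactly.
  have hterm : ∀ p ∈ indexPairs N, (‖x p.1 - x p.2‖ ^ 2)⁻¹ -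
      (blockDistSq β (β p.1) (β p.2))⁻¹ - ((blockDistSq β (β p.1) (β p.2)) ^ 2)⁻¹ *
      (blockDistSq β (β p.1) (β p.2) - ‖x p.1 - x p.2‖ ^ 2) =
      (‖x p.1 - x p.2‖ ^ 2 - blockDistSq β (β p.1) (β p.2)) ^ 2 /
        (‖x p.1 - x p.2‖ ^ 2 * blockDistSq β (β p.1) (β p.2) ^ 2) := by
    intro p hp
    have h₁ := ht _ _ (indexPairs_ne hp)
    have h₂ := lt_of_lt_of_le two_pos (blockDistSq_mem_Icc hβ (β p.1) (β p.2)).1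
    generalize ‖x p.1 - x p.2‖ ^ 2 = t at *
    field_simp
    ring
  have hnn : ∀ p ∈ indexPairs N, 0 ≤ (‖x p.1 - x p.2‖ ^ 2 -
      blockDistSq β (β p.1) (β p.2)) ^ 2 /
        (‖x p.1 - x p.2‖ ^ 2 * blockDistSq β (β p.1) (β p.2) ^ 2) :=
    fun p _ => by positivity
  have hsum := Finset.sum_congr rfl hterm
  rw [Finset.sum_sub_distrib, Finset.sum_sub_distrib, hinv] at hsum
  have hzero := (Finset.sum_eq_zero_iff_of_nonneg hnn).1
    (le_antisymm (by linarith) (Finset.sum_nonneg hnn))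
  have hlt : ∀ a b, a < b → ‖x a - x b‖ ^ 2 = blockDistSq β (β a) (β b) := by
    intro a b hab
    have h₀ := hzero (a, b) (by simpa [indexPairs] using hab)
    have h₁ := ht a b hab.ne
    have h₂ := lt_of_lt_of_le two_pos (blockDistSq_mem_Icc hβ (β a) (β b)).1
    rw [div_eq_zero_iff] at h₀
    rcases h₀ with h₀ | h₀
    · exact sub_eq_zero.1 (pow_eq_zero_iff two_ne_zero |>.1 h₀)
    · exact absurd h₀ (by positivity)
  refine .of_norm_sub_sq hβ hx fun a b hab => ?_
  rcases hab.lt_or_gt with h | h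
  · exact hlt a b h
  · rw [norm_sub_rev, blockDistSq_comm, hlt b a h]

theorem sum_indexPairs_blocks (β : Fin N → Fin k) (f : Fin k → ℝ) :
    2 * ∑ p ∈ indexPairs N, (if β p.1 = β p.2 then f (β p.1) else 0) =
      ∑ a, (blockSize β (β a) - 1 : ℝ) * f (β a) := by
  rw [two_mul_sum_indexPairs (fun a b => if β a = β b then f (β a) else 0)]
  · refine Finset.sum_congr rfl fun a _ => ?_
    have : ∀ b, (if a = b then 0 else if β a = β b then f (β a) else 0) =
        (if β b = β a then f (β a) else 0) - if a = b then f (β a) else 0 := by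
      intro b
      by_cases h : a = b
      · simp [h]
      · simp [h, eq_comm]
    simp only [this, Finset.sum_sub_distrib, Finset.sum_ite_eq, Finset.mem_univ, if_true]
    rw [← Finset.sum_filter, Finset.sum_const, nsmul_eq_mul, ← blockSize]
    ring
  · intro a b
    by_cases h : β a = β b
    · simp [h]
    · simp [h, Ne.symm h]

/-- Each point collects an excess of `M - 1` times `2/(M - 1)` from its block, whatever the size
`M`. -/
theorem sum_blockDistSq {β : Fin N → Fin k} (hβ : ∀ i, 2 ≤ blockSize β i) :
    ∑ p ∈ indexPairs N, blockDistSq β (β p.1) (β p.2) = 2 * (indexPairs N).card + N := by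
  have h₁ : ∀ i j, blockDistSq β i j =
      2 + if i = j then 2 / (blockSize β i - 1 : ℝ) else 0 := by
    intro i j
    unfold blockDistSq
    split_ifs <;> ring
  have h₂ := sum_indexPairs_blocks β fun i => 2 / (blockSize β i - 1 : ℝ)
  have h₃ : ∀ a, (blockSize β (β a) - 1 : ℝ) * (2 / (blockSize β (β a) - 1 : ℝ)) = 2 := by
    intro a
    have hM : (2 : ℝ) ≤ blockSize β (β a) := by exact_mod_cast hβ _
    exact mul_div_cancel₀ _ (by linarith)
  simp only [h₃, Finset.sum_const, Finset.card_univ, Fintype.card_fin, nsmul_eq_mul] at h₂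
  simp only [h₁, Finset.sum_add_distrib, Finset.sum_const, nsmul_eq_mul]
  linarith

/-- A block of size `M` lowers the total by `(M - 1)/4`, so only `N` and the number of blocks
matter. -/
theorem sum_inv_blockDistSq {β : Fin N → Fin k} (hβ : ∀ i, 2 ≤ blockSize β i) :
    ∑ p ∈ indexPairs N, (blockDistSq β (β p.1) (β p.2))⁻¹ =
      ((indexPairs N).card : ℝ) / 2 - (N - k) / 4 := by
  have hM : ∀ i, (2 : ℝ) ≤ blockSize β i := fun i => by exact_mod_cast hβ i
  have h₁ : ∀ i j, (blockDistSq β i j)⁻¹ =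
      1 / 2 - if i = j then 1 / (2 * blockSize β i : ℝ) else 0 := by
    intro i j
    have := hM i
    have h' : (blockSize β i - 1 : ℝ) ≠ 0 := by linarith
    unfold blockDistSq
    split_ifs
    · have e : 2 + 2 / (blockSize β i - 1 : ℝ) = 2 * blockSize β i / (blockSize β i - 1) := by
        field_simp
        ring
      rw [e]
      field_simp
    · norm_num
  have h₂ := sum_indexPairs_blocks β fun i => 1 / (2 * blockSize β i : ℝ)
  have h₃ : ∀ a, (blockSize β (β a) - 1 : ℝ) * (1 / (2 * blockSize β (β a) : ℝ)) =
      1 / 2 - (1 / 2) * (blockSize β (β a) : ℝ)⁻¹ := by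
    intro a
    have := hM (β a)
    field_simp
  have h₄ : ∑ a, (blockSize β (β a) : ℝ)⁻¹ = k := by
    rw [← Finset.sum_fiberwise Finset.univ β]
    have : ∀ i, ∑ a with β a = i, (blockSize β (β a) : ℝ)⁻¹ = 1 := by
      intro i
      rw [Finset.sum_congr rfl (g := fun _ => (blockSize β i : ℝ)⁻¹)
        (fun a ha => by rw [(Finset.mem_filter.1 ha).2]), Finset.sum_const, nsmul_eq_mul,
        ← blockSize, mul_inv_cancel₀]
      linarith [hM i]
    simp [this]
  simp only [h₃, Finset.sum_sub_distrib, ← Finset.mul_sum, h₄, Finset.sum_const,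
    Finset.card_univ, Fintype.card_fin, nsmul_eq_mul] at h₂
  simp only [h₁, Finset.sum_sub_distrib, Finset.sum_const, nsmul_eq_mul]
  linarith

/-- For `-2 ≤ s ≤ 2`, the `R_s`-values of two unions of simplices are equal or incomparable. -/
theorem Majorizes.eq_of_blockDistSq {s : ℝ} (hs : s ≤ 2) (hs' : -2 ≤ s) {β γ : Fin N → Fin k}
    (hβ : ∀ i, 2 ≤ blockSize β i) (hγ : ∀ i, 2 ≤ blockSize γ i)
    (h : Majorizes
      (blockValues β s)
      (blockValues γ s)) :
    blockValues β s =
      blockValues γ s := by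
  refine h.eq_of_rieszSq hs hs' ?_ ?_ ?_ ?_
  · intro t hmem
    obtain ⟨p, hp, rfl⟩ := Multiset.mem_map.1 hmem
    exact blockDistSq_mem_Icc hβ _ _
  · intro t hmem
    obtain ⟨p, hp, rfl⟩ := Multiset.mem_map.1 hmem
    exact blockDistSq_mem_Icc hγ _ _
  · exact (sum_blockDistSq hβ).trans (sum_blockDistSq hγ).symm
  · simp only [Multiset.map_map, Function.comp_def]
    exact (sum_inv_blockDistSq hβ).trans (sum_inv_blockDistSq hγ).symm

end Blocks

/-! ### Block models and unions of orthogonal regular simplices. -/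

section Simplices

open scoped InnerProductSpace

variable {E : Type*} [NormedAddCommGroup E] [InnerProductSpace ℝ E]

/-- Project the standard basis of `ℝⁿ⁺ᵏ` onto the `n`-dimensional orthogonal complement of the `k`
block indicators, then normalize. -/
theorem exists_isBlockSimplex {n k : ℕ} {β : Fin (n + k) → Fin k}
    (hβ : ∀ i, 2 ≤ blockSize β i) :
    ∃ y : Fin (n + k) → EuclideanSpace ℝ (Fin n), IsBlockSimplex β y := by
  have hM : ∀ i, (2 : ℝ) ≤ blockSize β i := fun i => by exact_mod_cast hβ i
  set e : Fin (n + k) → EuclideanSpace ℝ (Fin (n + k)) := fun a => EuclideanSpace.single a 1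
  set u : Fin k → EuclideanSpace ℝ (Fin (n + k)) :=
    fun i => WithLp.toLp 2 fun a => if β a = i then 1 else 0
  have hee : ∀ a b, ⟪e a, e b⟫_ℝ = if a = b then 1 else 0 := by
    intro a b
    simp [e, EuclideanSpace.inner_single_left]
  have heu : ∀ a i, ⟪e a, u i⟫_ℝ = if β a = i then 1 else 0 := by
    intro a i
    simp [e, u, EuclideanSpace.inner_single_left]
  have huu : ∀ i j, ⟪u i, u j⟫_ℝ = if i = j then (blockSize β i : ℝ) else 0 := by
    intro i j
    simp only [u, PiLp.inner_apply, RCLike.inner_apply, conj_trivial]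
    split_ifs with h
    · subst h
      simp only [mul_ite, mul_one, mul_zero, blockSize, Finset.card_filter]
      push_cast
      refine Finset.sum_congr rfl fun a _ => ?_
      split_ifs <;> rfl
    · apply Finset.sum_eq_zero
      intro a _
      by_cases h₁ : β a = i
      · simp [h₁, h]
      · simp [h₁]
  have hli : LinearIndependent ℝ u := by
    refine linearIndependent_of_ne_zero_of_inner_eq_zero (𝕜 := ℝ) ?_ ?_
    · intro i hi
      have := huu i i
      rw [hi, inner_zero_left, if_pos rfl] at this
      linarith [hM i]
    · intro i j hij
      rw [huu, if_neg hij]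
  set U := Submodule.span ℝ (Set.range u)
  have hU : Module.finrank ℝ U = k := by
    rw [finrank_span_eq_card hli, Fintype.card_fin]
  have hUo : Module.finrank ℝ Uᗮ = n := by
    have := U.finrank_add_finrank_orthogonal
    rw [hU, finrank_euclideanSpace_fin] at this
    omega
  have hz : ∀ a, e a - (blockSize β (β a) : ℝ)⁻¹ • u (β a) ∈ Uᗮ := by
    intro a
    rw [Submodule.mem_orthogonal]
    intro v hv
    induction hv using Submodule.span_induction with
    | mem v hv =>
      obtain ⟨i, rfl⟩ := hv
      rw [inner_sub_right, real_inner_smul_right, huu, real_inner_comm, heu]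
      by_cases h : β a = i
      · subst h
        rw [if_pos rfl, if_pos rfl, inv_mul_cancel₀, sub_self]
        linarith [hM (β a)]
      · rw [if_neg h, if_neg (Ne.symm h)]
        simp
    | zero => simp
    | add v w _ _ h₁ h₂ => rw [inner_add_left, h₁, h₂, add_zero]
    | smul r v _ h => rw [inner_smul_left, h, mul_zero]
  set z : Fin (n + k) → Uᗮ := fun a => ⟨_, hz a⟩
  have hzz : ∀ a b, ⟪z a, z b⟫_ℝ = (if a = b then 1 else 0) -
      if β a = β b then (blockSize β (β a) : ℝ)⁻¹ else 0 := by
    intro a b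
    have : ⟪z a, z b⟫_ℝ = ⟪(z a : EuclideanSpace ℝ (Fin (n + k))), (z b : _)⟫_ℝ := rfl
    rw [this]
    simp only [z, inner_sub_left, inner_sub_right, real_inner_smul_left, real_inner_smul_right,
      hee, huu, heu, real_inner_comm (e _) (u _)]
    by_cases h : β a = β b
    · have := hM (β b)
      simp only [h, if_true]
      field_simp
      ring
    · simp only [h, Ne.symm h, if_false]
      ring
  set φ := ((stdOrthonormalBasis ℝ Uᗮ).reindex (finCongr hUo)).repr
  -- The projected basis vectors have squared norm `1 - 1/M`.
  set c : Fin k → ℝ := fun i => Real.sqrt (blockSize β i / (blockSize β i - 1))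
  have hcc : ∀ i, c i * c i = blockSize β i / (blockSize β i - 1) := by
    intro i
    refine Real.mul_self_sqrt (div_nonneg ?_ ?_) <;> linarith [hM i]
  have hyy : ∀ a b, ⟪c (β a) • φ (z a), c (β b) • φ (z b)⟫_ℝ = (if a = b then 1 else 0) +
      if β a = β b ∧ a ≠ b then -1 / (blockSize β (β a) - 1 : ℝ) else 0 := by
    intro a b
    rw [real_inner_smul_left, real_inner_smul_right, LinearIsometryEquiv.inner_map_map, hzz,
      ← mul_assoc]
    by_cases h : β a = β b
    · have h₁ := hM (β b)
      have h₂ : (blockSize β (β b) - 1 : ℝ) ≠ 0 := by linarith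
      rw [h, hcc]
      by_cases hab : a = b
      · simp only [hab, if_true, ne_eq, not_true, and_false, if_false]
        field_simp
        simp
      · simp only [hab, if_true, if_false, ne_eq, not_false_eq_true, and_self]
        field_simp
        simp
    · have hab : a ≠ b := fun hab => h (congrArg β hab)
      simp [h, hab]
  refine ⟨fun a => c (β a) • φ (z a), ?_, ?_⟩
  · intro a
    have := hyy a a
    rw [real_inner_self_eq_norm_sq] at this
    simp only [if_true, ne_eq, not_true, and_false, if_false, add_zero] at this
    exact (pow_eq_one_iff_of_nonneg (norm_nonneg _) two_ne_zero).1 this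
  · intro a b hab
    rw [norm_sub_sq_real, ← real_inner_self_eq_norm_sq, ← real_inner_self_eq_norm_sq, hyy, hyy,
      hyy, blockDistSq]
    simp only [hab, if_true, ne_eq, not_true, not_false_eq_true, and_false, and_true, if_false,
      add_zero, zero_add]
    split_ifs <;> ring

namespace IsBlockSimplex

variable {N k : ℕ} {β : Fin N → Fin k} {x : Fin N → E}

theorem inner_eq (hx : IsBlockSimplex β x) {a b : Fin N} (hab : a ≠ b) :
    ⟪x a, x b⟫_ℝ = if β a = β b then -1 / (blockSize β (β a) - 1 : ℝ) else 0 := by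
  have h := hx.norm_sub_sq a b hab
  rw [norm_sub_sq_real, hx.norm_eq, hx.norm_eq, blockDistSq] at h
  split_ifs at h ⊢
  · rw [neg_div]
    linear_combination (-1 / 2 : ℝ) * h
  · linarith

theorem sum_block_eq_zero (hβ : ∀ i, 2 ≤ blockSize β i) (hx : IsBlockSimplex β x) (i : Fin k) :
    ∑ a with β a = i, x a = 0 := by
  have h := sum_block_eq hβ x i
  rw [Finset.sum_eq_zero] at h
  · have h₀ : ∑ a with β a = i, (1 - ‖x a‖ ^ 2) = 0 :=
      Finset.sum_eq_zero fun a _ => by rw [hx.norm_eq]; norm_num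
    rw [h₀, mul_zero, zero_add] at h
    have h₁ : ‖∑ a with β a = i, x a‖ ^ 2 = 0 := by linarith
    exact norm_eq_zero.1 (pow_eq_zero_iff two_ne_zero |>.1 h₁)
  · intro a ha
    refine Finset.sum_eq_zero fun b hb => ?_
    rw [Finset.mem_filter] at ha hb
    split_ifs with hab
    · rfl
    · rw [hx.norm_sub_sq a b hab, ha.2, hb.2, sub_self]

theorem isOrthogonalSimplexUnion [DecidableEq E] {n : ℕ} (hN : N = n + k)
    (hβ : ∀ i, 2 ≤ blockSize β i) (hx : IsBlockSimplex β x) :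
    IsOrthogonalSimplexUnion n k (Finset.univ.image x) := by
  classical
  have hM : ∀ i, (2 : ℝ) ≤ blockSize β i := fun i => by exact_mod_cast hβ i
  have hd : ∀ i, blockSize β i = (blockSize β i - 1) + 1 := fun i => by have := hβ i; omega
  have e : ∀ i, {f : Fin ((blockSize β i - 1) + 1) → Fin N // Function.Injective f ∧
      ∀ a, β a = i ↔ a ∈ Set.range f} := by
    intro i
    let e := Finset.equivFinOfCardEq (s := Finset.univ.filter fun a => β a = i) (hd i)
    refine ⟨fun j => (e.symm j : Fin N), ?_, ?_⟩
    · exact Subtype.val_injective.comp e.symm.injective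
    · intro a
      constructor
      · intro h
        exact ⟨e ⟨a, by simpa using h⟩, by simp⟩
      · rintro ⟨j, rfl⟩
        exact (Finset.mem_filter.1 (e.symm j).2).2
  have hinner : ∀ i j l, ⟪x ((e i).1 j), x ((e i).1 l)⟫_ℝ = -1 / (blockSize β i - 1 : ℝ) +
      if j = l then 1 + 1 / (blockSize β i - 1 : ℝ) else 0 := by
    intro i j l
    by_cases hjl : j = l
    · rw [hjl, real_inner_self_eq_norm_sq, hx.norm_eq, if_pos rfl]
      ring
    · have h₁ := ((e i).2.2 _).2 ⟨j, rfl⟩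
      have h₂ := ((e i).2.2 _).2 ⟨l, rfl⟩
      rw [hx.inner_eq ((e i).2.1.ne hjl), h₁, h₂, if_pos rfl, if_neg hjl, add_zero]
  have haff : ∀ i, AffineIndependent ℝ (x ∘ (e i).1) := by
    intro i
    rw [affineIndependent_iff]
    intro s w hw h₀ j hj
    have h := congrArg (fun v => ⟪v, x ((e i).1 j)⟫_ℝ) h₀
    simp only [sum_inner, real_inner_smul_left, inner_zero_left, Function.comp_apply, hinner,
      mul_add, Finset.sum_add_distrib, ← Finset.sum_mul, hw, zero_mul, zero_add, mul_ite, mul_zero,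
      Finset.sum_ite_eq', hj, if_true] at h
    rw [← mul_add] at h
    refine (mul_eq_zero.1 h).resolve_right ?_
    have : 0 < 1 / (blockSize β i - 1 : ℝ) := one_div_pos.2 (by linarith [hM i])
    linarith
  refine ⟨fun i => blockSize β i - 1, fun i => Submodule.span ℝ (Set.range (x ∘ (e i).1)),
    fun i => Finset.univ.image (x ∘ (e i).1), fun i => ?_, ?_, fun i => ?_, fun i j hij => ?_,
    fun i => ?_, fun i v hv => ?_, ?_⟩
  · have := hβ i
    exact Nat.le_sub_of_add_le this
  · have h₁ : ∑ i, blockSize β i = N := by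
      have := Finset.card_eq_sum_card_fiberwise (f := β) (s := Finset.univ) (t := Finset.univ)
        (fun _ _ => Finset.mem_coe.2 (Finset.mem_univ _))
      rw [Finset.card_univ, Fintype.card_fin] at this
      exact this.symm
    have h₂ : ∑ i, ((blockSize β i - 1) + 1) = N :=
      (Finset.sum_congr rfl fun i _ => (hd i).symm).trans h₁
    rw [Finset.sum_add_distrib] at h₂
    simp only [Finset.sum_const, Finset.card_univ, Fintype.card_fin, smul_eq_mul, mul_one] at h₂
    dsimp only
    omega
  · have : FiniteDimensional ℝ (Submodule.span ℝ (Set.range (x ∘ (e i).1))) :=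
      FiniteDimensional.span_of_finite ℝ (Set.finite_range _)
    dsimp only
    -- The block sums to zero, so it is dependent; affine independence gives the reverse bound.
    apply le_antisymm
    · have h₁ := finrank_range_le_card (R := ℝ) (x ∘ (e i).1)
      have h₂ : ¬ LinearIndependent ℝ (x ∘ (e i).1) := by
        rw [Fintype.not_linearIndependent_iff]
        refine ⟨fun _ => 1, ?_, 0, one_ne_zero⟩
        rw [← hx.sum_block_eq_zero hβ i]
        simp only [one_smul, Function.comp_apply]
        rw [← Finset.sum_image (f := x) (g := (e i).1) (s := Finset.univ)
          fun a _ b _ h => (e i).2.1 h]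
        refine Finset.sum_congr ?_ fun _ _ => rfl
        ext a
        simp [(e i).2.2 a]
      rw [linearIndependent_iff_card_eq_finrank_span] at h₂
      simp only [Fintype.card_fin, Set.finrank] at h₁ h₂
      omega
    · refine ((haff i).finrank_vectorSpan (Fintype.card_fin _)).ge.trans
        (Submodule.finrank_mono ?_)
      rw [vectorSpan_def, Submodule.span_le]
      rintro _ ⟨u, hu, v, hv, rfl⟩
      exact sub_mem (Submodule.subset_span hu) (Submodule.subset_span hv)
  · rw [Submodule.isOrtho_span]
    rintro _ ⟨a, rfl⟩ _ ⟨b, rfl⟩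
    have h₁ := ((e i).2.2 _).2 ⟨a, rfl⟩
    have h₂ := ((e j).2.2 _).2 ⟨b, rfl⟩
    have hne : (e i).1 a ≠ (e j).1 b := fun h => hij (by rw [← h₁, h, h₂])
    rw [Function.comp_apply, Function.comp_apply, hx.inner_eq hne, h₁, h₂, if_neg hij]
  · refine ⟨⟨x ∘ (e i).1, haff i⟩, ⟨Real.sqrt (blockDistSq β i i), fun a b hab => ?_⟩, ?_⟩
    swap
    · rw [Finset.coe_image, Finset.coe_univ, Set.image_univ]
    have h₁ := ((e i).2.2 _).2 ⟨a, rfl⟩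
    have h₂ := ((e i).2.2 _).2 ⟨b, rfl⟩
    have := hx.norm_sub_sq _ _ ((e i).2.1.ne hab)
    rw [h₁, h₂] at this
    rw [← this, Real.sqrt_sq (norm_nonneg _), dist_eq_norm]
    rfl
  · obtain ⟨a, -, rfl⟩ := Finset.mem_image.1 hv
    exact ⟨Submodule.subset_span ⟨a, rfl⟩, hx.norm_eq _⟩
  · ext v
    simp only [Finset.coe_image, Finset.coe_univ, Set.image_univ, Set.mem_range, Set.mem_iUnion,
      Function.comp_apply]
    constructor
    · rintro ⟨a, rfl⟩
      obtain ⟨j, hj⟩ := ((e (β a)).2.2 a).1 rfl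
      exact ⟨β a, j, by rw [hj]⟩
    · rintro ⟨i, j, rfl⟩
      exact ⟨_, rfl⟩

end IsBlockSimplex

/-- The `d + 1` vertices are dependent in `L`, and their Gram matrix is a constant plus a multiple
of the identity. Pairing the dependency with every vertex and summing determines the edge length. -/
theorem norm_sub_sq_of_regular_inscribed {d : ℕ} (hd : 1 ≤ d) (L : Submodule ℝ E)
    [FiniteDimensional ℝ L] (hL : Module.finrank ℝ L = d) (σ : Affine.Simplex ℝ E d)
    (hσ : σ.Equilateral) (hmem : ∀ a, σ.points a ∈ L) (hnorm : ∀ a, ‖σ.points a‖ = 1)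
    {a b : Fin (d + 1)} (hab : a ≠ b) : ‖σ.points a - σ.points b‖ ^ 2 = 2 + 2 / (d : ℝ) := by
  classical
  obtain ⟨r, hr⟩ := hσ
  have hdist : ∀ i j, i ≠ j → ‖σ.points i - σ.points j‖ = r := fun i j hij => by
    rw [← dist_eq_norm, hr i j hij]
  have hr0 : 0 < r := by
    rw [← hdist a b hab, norm_pos_iff, sub_ne_zero]
    exact σ.independent.injective.ne hab
  have hinner : ∀ i j, ⟪σ.points i, σ.points j⟫_ℝ =
      (1 - r ^ 2 / 2) + if i = j then r ^ 2 / 2 else 0 := by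
    intro i j
    by_cases hij : i = j
    · rw [hij, real_inner_self_eq_norm_sq, hnorm, if_pos rfl]
      ring
    · have h := norm_sub_sq_real (σ.points i) (σ.points j)
      rw [hdist i j hij, hnorm, hnorm] at h
      rw [if_neg hij]
      linarith
  have hdep : ¬ LinearIndependent ℝ fun i => (⟨σ.points i, hmem i⟩ : L) := by
    intro h
    have := h.fintype_card_le_finrank
    rw [Fintype.card_fin, hL] at this
    omega
  obtain ⟨w, hw, l, hl⟩ := Fintype.not_linearIndependent_iff.1 hdep
  have hw' : ∑ i, w i • σ.points i = 0 := by
    have := congrArg (Subtype.val : L → E) hw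
    simpa using this
  have h₁ : ∀ j, (∑ i, w i) * (1 - r ^ 2 / 2) + w j * (r ^ 2 / 2) = 0 := by
    intro j
    have h := congrArg (fun v => ⟪v, σ.points j⟫_ℝ) hw'
    simpa only [sum_inner, real_inner_smul_left, inner_zero_left, hinner, mul_add,
      Finset.sum_add_distrib, ← Finset.sum_mul, mul_ite, mul_zero, Finset.sum_ite_eq',
      Finset.mem_univ, if_true] using h
  have h₂ := Finset.sum_congr rfl fun j (_ : j ∈ Finset.univ) => h₁ j
  simp only [Finset.sum_add_distrib, ← Finset.sum_mul, Finset.sum_const, Finset.card_univ,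
    Fintype.card_fin, nsmul_eq_mul] at h₂
  have hne : ∑ i, w i ≠ 0 := by
    intro h₀
    have := h₁ l
    rw [h₀, zero_mul, zero_add] at this
    rcases mul_eq_zero.1 this with h | h
    · exact hl h
    · exact absurd h (by positivity)
  have hd0 : (d : ℝ) ≠ 0 := by positivity
  rw [hdist a b hab]
  have h₃ : (∑ i, w i) * (d * r ^ 2 - (2 * d + 2)) = 0 := by
    push_cast at h₂
    linear_combination (-2 : ℝ) * h₂
  have h₄ := (mul_eq_zero.1 h₃).resolve_left hne
  field_simp
  linarith

theorem IsOrthogonalSimplexUnion.exists_isBlockSimplex [DecidableEq E] [FiniteDimensional ℝ E]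
    {n k : ℕ} {X : Finset E} (hX : IsOrthogonalSimplexUnion n k X) :
    ∃ (β : Fin (n + k) → Fin k) (x : Fin (n + k) → E), (∀ i, 2 ≤ blockSize β i) ∧
      IsBlockSimplex β x ∧ X = Finset.univ.image x := by
  classical
  obtain ⟨d, L, S, hd, hsum, hL, hLL, hS, hSL, hXS⟩ := hX
  choose σ hσ hσS using hS
  have hmem : ∀ i a, (σ i).points a ∈ L i ∧ ‖(σ i).points a‖ = 1 := by
    intro i a
    apply hSL i
    rw [← Finset.mem_coe, ← hσS i]
    exact ⟨a, rfl⟩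
  have hcard : Fintype.card (Σ i, Fin (d i + 1)) = n + k := by
    simp [Finset.sum_add_distrib, hsum]
  let e := (Fintype.equivFinOfCardEq hcard).symm
  have hsize : ∀ i, blockSize (fun a => (e a).1) i = d i + 1 := by
    intro i
    have h₁ : Fintype.card {a // (e a).1 = i} = Fintype.card (Fin (d i + 1)) :=
      Fintype.card_congr ((e.subtypeEquiv fun _ => Iff.rfl).trans (Equiv.sigmaSubtype i))
    rw [Fintype.card_fin, Fintype.card_subtype] at h₁
    exact h₁
  refine ⟨fun a => (e a).1, fun a => (σ (e a).1).points (e a).2, fun i => ?_, ⟨?_, ?_⟩, ?_⟩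
  · rw [hsize]
    have := hd i
    omega
  · exact fun a => (hmem _ _).2
  · intro a b hab
    have hab' := e.injective.ne hab
    rw [blockDistSq, hsize]
    generalize e a = u at *
    generalize e b = v at *
    obtain ⟨i, u⟩ := u
    obtain ⟨j, v⟩ := v
    dsimp only
    split_ifs with hij
    · subst hij
      have huv : u ≠ v := fun h => hab' (by rw [h])
      rw [norm_sub_sq_of_regular_inscribed (hd i) (L i) (hL i) (σ i) (hσ i)
        (fun a => (hmem i a).1) (fun a => (hmem i a).2) huv]
      push_cast
      ring
    · have h₀ : ⟪(σ i).points u, (σ j).points v⟫_ℝ = 0 :=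
        Submodule.isOrtho_iff_inner_eq.1 (hLL i j hij) _ (hmem i u).1 _ (hmem j v).1
      rw [norm_sub_sq_real, h₀, (hmem _ _).2, (hmem _ _).2]
      norm_num
  · apply Finset.coe_injective
    rw [hXS, Finset.coe_image, Finset.coe_univ, Set.image_univ]
    ext v
    simp only [Set.mem_iUnion, ← hσS, Set.mem_range]
    constructor
    · rintro ⟨i, a, rfl⟩
      exact ⟨e.symm ⟨i, a⟩, by rw [e.apply_symm_apply]⟩
    · rintro ⟨a, rfl⟩
      exact ⟨_, _, rfl⟩

end Simplices

/-! ### Maximal configurations. -/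

section Main

open scoped InnerProductSpace

/-- The two alternatives together say exactly that `X` is maximal for the majorization preorder. -/
theorem mem_MSets_iff {E : Type*} [MetricSpace E] [DecidableEq E] {S : Set E} {ρ : SymmFun E}
    {q : ℝ} {m : ℕ} {X : Finset E} :
    X ∈ MSets S ρ q m ↔ X ∈ constrainedSets S q m ∧ ∀ Y ∈ constrainedSets S q m,
      Majorizes (pairValues ρ Y) (pairValues ρ X) →
        Majorizes (pairValues ρ X) (pairValues ρ Y) := by
  refine and_congr_right fun _ => forall₂_congr fun Y _ => ?_
  tauto

variable {n k : ℕ}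

theorem exists_orthogonal_blocks_of_sqrt_two_le_dist (hk : 2 ≤ k)
    (x : Fin (n + k) → EuclideanSpace ℝ (Fin n)) (hx : ∀ a, ‖x a‖ ≤ 1)
    (hd : ∀ a b, a ≠ b → Real.sqrt 2 ≤ dist (x a) (x b)) :
    ∃ β : Fin (n + k) → Fin k, (∀ i, 2 ≤ blockSize β i) ∧
      ∀ a b, β a ≠ β b → ⟪x a, x b⟫_ℝ = 0 := by
  have hsq : ∀ a, ‖x a‖ ^ 2 ≤ 1 := fun a => pow_le_one₀ (norm_nonneg _) (hx a)
  have hd2 : ∀ a b, a ≠ b → 2 ≤ ‖x a‖ ^ 2 - 2 * ⟪x a, x b⟫_ℝ + ‖x b‖ ^ 2 := by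
    intro a b hab
    rw [← norm_sub_sq_real, ← dist_eq_norm]
    exact (Real.sqrt_le_left dist_nonneg).1 (hd a b hab)
  have hinner : ∀ a b, a ≠ b → ⟪x a, x b⟫_ℝ ≤ 0 := fun a b hab => by
    linarith [hd2 a b hab, hsq a, hsq b]
  have hne : ∀ a, x a ≠ 0 := by
    intro a ha
    have : Nontrivial (Fin (n + k)) := Fin.nontrivial_iff_two_le.2 (by omega)
    obtain ⟨b, hb⟩ := exists_ne a
    have := hd2 a b hb.symm
    rw [ha] at this
    simp only [norm_zero, inner_zero_left] at this
    linarith [hsq b]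
  obtain ⟨k, rfl⟩ : ∃ l, k = l + 1 := ⟨k - 1, by omega⟩
  obtain ⟨β, hβ, hβ2, hβo⟩ := exists_orthogonal_blocks x hne hinner k Finset.univ (by
    have := Submodule.finrank_le
      (Submodule.span ℝ (x '' (Finset.univ : Finset (Fin (n + (k + 1))))))
    rw [finrank_euclideanSpace_fin] at this
    rw [Finset.card_univ, Fintype.card_fin]
    omega)
  refine ⟨fun a => ⟨β a, hβ a (Finset.mem_univ a)⟩, fun i => ?_, fun a b hab => ?_⟩
  · simpa only [blockSize, Fin.ext_iff] using hβ2 i i.2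
  · exact hβo a (Finset.mem_univ a) b (Finset.mem_univ b) fun h => hab (Fin.ext h)

theorem IsBlockSimplex.mem_constrainedSets {E : Type*} [NormedAddCommGroup E]
    [InnerProductSpace ℝ E] [DecidableEq E] {N : ℕ} {β : Fin N → Fin k}
    (hβ : ∀ i, 2 ≤ blockSize β i) {x : Fin N → E} (hx : IsBlockSimplex β x) :
    Finset.univ.image x ∈ constrainedSets (Metric.sphere (0 : E) 1) (Real.sqrt 2) N := by
  refine ⟨?_, ?_, ?_⟩
  · intro v hv
    obtain ⟨a, -, rfl⟩ := Finset.mem_image.1 (Finset.mem_coe.1 hv)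
    rw [mem_sphere_zero_iff_norm, hx.norm_eq]
  · rw [Finset.card_image_of_injective _ (hx.injective hβ), Finset.card_univ, Fintype.card_fin]
  · intro v hv w hw hvw
    obtain ⟨a, -, rfl⟩ := Finset.mem_image.1 hv
    obtain ⟨b, -, rfl⟩ := Finset.mem_image.1 hw
    have hab : a ≠ b := fun h => hvw (congrArg x h)
    rw [Real.sqrt_le_left dist_nonneg, dist_eq_norm, hx.norm_sub_sq a b hab]
    exact (blockDistSq_mem_Icc hβ _ _).1

theorem exists_blockValues_majorizes [DecidableEq (EuclideanSpace ℝ (Fin n))] (hk : 2 ≤ k) {s : ℝ}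
    (hs : s ≤ 2) {X : Finset (EuclideanSpace ℝ (Fin n))}
    (hX : X ∈ constrainedSets (Metric.closedBall (0 : EuclideanSpace ℝ (Fin n)) 1)
      (Real.sqrt 2) (n + k)) :
    ∃ β : Fin (n + k) → Fin k, (∀ i, 2 ≤ blockSize β i) ∧
      Majorizes (blockValues β s) (pairValues (rieszFun s) X) ∧
      (pairValues (rieszFun s) X = blockValues β s → IsOrthogonalSimplexUnion n k X) := by
  obtain ⟨hXS, hXc, hXd⟩ := hX
  let e := (X.equivFinOfCardEq hXc).symm
  set x : Fin (n + k) → EuclideanSpace ℝ (Fin n) := fun a => e a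
  have hinj : Function.Injective x := Subtype.val_injective.comp e.injective
  have himage : X = Finset.univ.image x := by
    ext v
    simp only [Finset.mem_image, Finset.mem_univ, true_and]
    constructor
    · intro hv
      exact ⟨e.symm ⟨v, hv⟩, by simp [x]⟩
    · rintro ⟨a, rfl⟩
      exact (e a).2
  have hx : ∀ a, ‖x a‖ ≤ 1 := fun a => mem_closedBall_zero_iff.1 (hXS (e a).2)
  obtain ⟨β, hβ, ho⟩ := exists_orthogonal_blocks_of_sqrt_two_le_dist hk x hx
    fun a b hab => hXd _ (e a).2 _ (e b).2 (hinj.ne hab)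
  rw [himage]
  exact ⟨β, hβ, majorizes_blockDistSq hs hβ hinj hx ho, fun h =>
    (IsBlockSimplex.of_pairValues_eq hs hβ hinj hx ho h).isOrthogonalSimplexUnion rfl hβ⟩

theorem exists_forall_two_le_blockSize (hk : 1 ≤ k) (hkn : k ≤ n) :
    ∃ β : Fin (n + k) → Fin k, ∀ i, 2 ≤ blockSize β i := by
  refine ⟨fun a => ⟨a % k, Nat.mod_lt _ hk⟩, fun i => ?_⟩
  rw [blockSize, Nat.succ_le_iff, Finset.one_lt_card]
  -- The residue class of `i` modulo `k` contains `i` and `i + k`, the latter in range because `k ≤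
  -- n`.
  refine ⟨⟨i, by omega⟩, ?_, ⟨i + k, by omega⟩, ?_, ?_⟩
  · simp [Fin.ext_iff, Nat.mod_eq_of_lt i.2]
  · simp [Fin.ext_iff, Nat.mod_eq_of_lt i.2]
  · simp [Fin.ext_iff]
    omega

theorem exists_maximal_blockValues (hk : 1 ≤ k) (hkn : k ≤ n) (s : ℝ) :
    ∃ β : Fin (n + k) → Fin k, (∀ i, 2 ≤ blockSize β i) ∧
      ∀ γ : Fin (n + k) → Fin k, (∀ i, 2 ≤ blockSize γ i) →
        Majorizes (blockValues γ s) (blockValues β s) →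
          Majorizes (blockValues β s) (blockValues γ s) := by
  let r : (Fin (n + k) → Fin k) → (Fin (n + k) → Fin k) → Prop := fun γ β =>
    Majorizes (blockValues γ s) (blockValues β s) ∧ ¬ Majorizes (blockValues β s) (blockValues γ s)
  have : IsTrans _ r := ⟨fun _ _ _ h₁ h₂ => ⟨h₁.1.trans h₂.1, fun h => h₁.2 (h₂.1.trans h)⟩⟩
  have : Std.Irrefl r := ⟨fun _ h => h.2 h.1⟩
  obtain ⟨β, hβ, hmin⟩ := (Finite.wellFounded_of_trans_of_irrefl r).has_min
    {β | ∀ i, 2 ≤ blockSize β i} (exists_forall_two_le_blockSize hk hkn)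
  exact ⟨β, hβ, fun γ hγ h => by_contra fun h' => hmin γ hγ ⟨h, h'⟩⟩

end Main

open scoped Classical in
theorem mainTheorem3 (n k : ℕ) (hk : 2 ≤ k) (hkn : k ≤ n) (s : ℝ) (hs : s ≤ 2) :
    MSets (Metric.closedBall (0 : EuclideanSpace ℝ (Fin n)) 1) (rieszFun s) (Real.sqrt 2) (n + k) =
        MSets (Metric.sphere (0 : EuclideanSpace ℝ (Fin n)) 1) (rieszFun s) (Real.sqrt 2) (n + k) ∧
      (MSets (Metric.sphere (0 : EuclideanSpace ℝ (Fin n)) 1) (rieszFun s) (Real.sqrt 2)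
        (n + k)).Nonempty ∧
      (∀ X ∈ MSets (Metric.sphere (0 : EuclideanSpace ℝ (Fin n)) 1) (rieszFun s) (Real.sqrt 2)
        (n + k), IsOrthogonalSimplexUnion n k X) ∧
      (-2 ≤ s → ∀ X : Finset (EuclideanSpace ℝ (Fin n)), IsOrthogonalSimplexUnion n k X →
        X ∈ MSets (Metric.sphere (0 : EuclideanSpace ℝ (Fin n)) 1) (rieszFun s) (Real.sqrt 2)
          (n + k)) := by
  have hsub : ∀ X ∈ constrainedSets (Metric.sphere (0 : EuclideanSpace ℝ (Fin n)) 1)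
      (Real.sqrt 2) (n + k), X ∈ constrainedSets
        (Metric.closedBall (0 : EuclideanSpace ℝ (Fin n)) 1) (Real.sqrt 2) (n + k) :=
    fun X hX => ⟨hX.1.trans Metric.sphere_subset_closedBall, hX.2⟩
  have hunion : ∀ X : Finset (EuclideanSpace ℝ (Fin n)), IsOrthogonalSimplexUnion n k X →
      ∃ β : Fin (n + k) → Fin k, (∀ i, 2 ≤ blockSize β i) ∧
        X ∈ constrainedSets (Metric.sphere (0 : EuclideanSpace ℝ (Fin n)) 1)
          (Real.sqrt 2) (n + k) ∧ pairValues (rieszFun s) X = blockValues β s := by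
    intro X hX
    obtain ⟨β, x, hβ, hx, rfl⟩ := hX.exists_isBlockSimplex
    exact ⟨β, hβ, hx.mem_constrainedSets hβ, hx.pairValues_eq hβ s⟩
  have hcan : ∀ β : Fin (n + k) → Fin k, (∀ i, 2 ≤ blockSize β i) →
      ∃ Y ∈ constrainedSets (Metric.sphere (0 : EuclideanSpace ℝ (Fin n)) 1)
          (Real.sqrt 2) (n + k), pairValues (rieszFun s) Y = blockValues β s := by
    intro β hβ
    obtain ⟨y, hy⟩ := exists_isBlockSimplex hβ
    exact ⟨_, hy.mem_constrainedSets hβ, hy.pairValues_eq hβ s⟩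
  -- Maximality against competitors on the sphere is enough, even for `X` in the ball, since the
  -- models lie on the sphere.
  have hmax : ∀ X ∈ constrainedSets (Metric.closedBall (0 : EuclideanSpace ℝ (Fin n)) 1)
      (Real.sqrt 2) (n + k), (∀ Y ∈ constrainedSets
        (Metric.sphere (0 : EuclideanSpace ℝ (Fin n)) 1) (Real.sqrt 2) (n + k),
        Majorizes (pairValues (rieszFun s) Y) (pairValues (rieszFun s) X) →
          Majorizes (pairValues (rieszFun s) X) (pairValues (rieszFun s) Y)) →
      IsOrthogonalSimplexUnion n k X := by
    intro X hX h
    obtain ⟨β, hβ, hmaj, heq⟩ := exists_blockValues_majorizes hk hs hX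
    obtain ⟨Y, hY, hYβ⟩ := hcan β hβ
    rw [← hYβ] at hmaj heq
    exact heq ((h Y hY hmaj).antisymm hmaj)
  -- Any competitor is majorized by some model, so a model need only be maximal among models.
  have hdom : ∀ β : Fin (n + k) → Fin k, (∀ γ : Fin (n + k) → Fin k,
      (∀ i, 2 ≤ blockSize γ i) → Majorizes (blockValues γ s) (blockValues β s) →
        Majorizes (blockValues β s) (blockValues γ s)) →
      ∀ X ∈ constrainedSets (Metric.sphere (0 : EuclideanSpace ℝ (Fin n)) 1)
        (Real.sqrt 2) (n + k), pairValues (rieszFun s) X = blockValues β s →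
      X ∈ MSets (Metric.sphere (0 : EuclideanSpace ℝ (Fin n)) 1) (rieszFun s) (Real.sqrt 2)
        (n + k) := by
    intro β hβ X hX hXβ
    refine mem_MSets_iff.2 ⟨hX, fun Z hZ h => ?_⟩
    obtain ⟨γ, hγ, hmaj, -⟩ := exists_blockValues_majorizes hk hs (hsub Z hZ)
    rw [hXβ] at h ⊢
    exact (hβ γ hγ (hmaj.trans h)).trans hmaj
  refine ⟨?_, ?_, ?_, ?_⟩
  · ext X
    rw [mem_MSets_iff, mem_MSets_iff]
    constructor
    · rintro ⟨hX, h⟩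
      have h' := fun Y hY => h Y (hsub Y hY)
      obtain ⟨-, -, hXS, -⟩ := hunion X (hmax X hX h')
      exact ⟨hXS, h'⟩
    · rintro ⟨hX, h⟩
      refine ⟨hsub X hX, fun Z hZ hZX => ?_⟩
      obtain ⟨β, hβ, hmaj, -⟩ := exists_blockValues_majorizes hk hs hZ
      obtain ⟨Y, hY, hYβ⟩ := hcan β hβ
      rw [← hYβ] at hmaj
      exact (h Y hY (hmaj.trans hZX)).trans hmaj
  · obtain ⟨β, hβ, hβmax⟩ := exists_maximal_blockValues (by omega) hkn s
    obtain ⟨Y, hY, hYβ⟩ := hcan β hβ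
    exact ⟨Y, hdom β hβmax Y hY hYβ⟩
  · intro X hX
    rw [mem_MSets_iff] at hX
    exact hmax X (hsub X hX.1) hX.2
  · intro hs' X hX
    obtain ⟨β, hβ, hXS, hXβ⟩ := hunion X hX
    refine hdom β (fun γ hγ h => ?_) X hXS hXβ
    rw [h.eq_of_blockDistSq hs hs' hγ hβ]
    exact .refl _
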